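/- **Setting.** Let $n\ge 1$, let $X=(X_1,\dots,X_K)\in\mathbb{R}^{n\times p}$ be a fixed design matrix with blocks $X_k\in\mathbb{R}^{n\times p_k}$, $p=\sum_k p_k$, and let $Y=XB_0+E=\sum_{k=1}^K X_kB_{0k}+E\in\mathbb{R}^{n\times q}$, where $B_0=(B_{01}^{T},\dots,B_{0K}^{T})^{T}\in\mathbb{R}^{p\times q}$ and $E$ has i.i.d. $N(0,\tau^2)$ entries, $\tau>0$. Write $\sigma(A,j)$ for the $j$-th largest singular value of $A$, $\|A\|_\star=\sum_j\sigma(A,j)$ for the nuclear norm, $\|A\|_F$ for the Frobenius norm, $r(A)$ for the rank, $Z_k=X_k^{T}X_k/n$, $\Lambda(Z_k,1)$ for the largest eigenvalue of $Z_k$, $m_k=\min(p_k,q)$, and $w_k=\sigma(X_k,1)\{\sqrt q+\sqrt{r(X_k)}\}/n$. For $\lambda>0$ let $$\widehat B\in\arg\min_{B\in\mathbb{R}^{p\times q}}\ \frac1{2n}\|Y-XB\|_F^2+\lambda\sum_{k=1}^K w_k\|B_k\|_\star .$$ **Restricted eigenvalue condition.** Let $1\le r_k\le m_k$ be integers and $\delta\in\mathbb{R}$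 a tolerance parameter. Let $B_{0k}=U_kD_kV_k^{T}$ be a full singular value decomposition with decreasing singular values, and let $U_k^{r_k},V_k^{r_k}$ consist of the first $r_k$ columns of $U_k,V_k$. For $\Delta=(\Delta_1^{T},\dots,\Delta_K^{T})^{T}\in\mathbb{R}^{p\times q}$ let $\Delta_k''$ be the orthogonal projection (for the Frobenius inner product) of $\Delta_k$ onto the subspace of matrices in $\mathbb{R}^{p_k\times q}$ whose row space is orthogonal to the columns of $V_k^{r_k}$ and whose column space is orthogonal to the columns of $U_k^{r_k}$, and let $\Delta_k'=\Delta_k-\Delta_k''$. Define $$\mathcal C(r_1,\dots,r_K;\delta)=\Big\{\Delta:\ \|\Delta\|_F\ge\delta,\ \sum_{k=1}^K w_k\|\Delta_k''\|_\star\le\sum_{k=1}^K\Big(3w_k\|\Delta_k'\|_\star+4w_k\sum_{j=r_k+1}^{m_k}\sigma(B_{0k},j)\Big)\Big\}.$$ Suppose that $\kappa(X)>0$ satisfies $\frac1{2n}\|X\Delta\|_F^2\ge\kappa(X)\|\Delta\|_F^2$ for all $\Delta\in\mathcal C(r_1,\dots,r_K;\delta)$. **Theorem.** There is a universal constant $C>0$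 such that, in this setting, for every $\theta>0$ and with $\lambda=2(1+\theta)\tau$, with probability at least $1-\sum_{k=1}^K\exp[-\theta^2\{q+r(X_k)\}/2]$, every such minimizer $\widehat B$ satisfies $$\|\widehat B-B_0\|_F^2\le C\max\Big\{\delta^2,\ \tau^2(1+\theta)^2\sum_{k=1}^K\frac{\Lambda(Z_k,1)}{\kappa(X)^2}\frac{\{\sqrt q+\sqrt{r(X_k)}\}^2r_k}{n},\ \tau(1+\theta)\sum_{k=1}^K\frac{\sqrt{\Lambda(Z_k,1)}}{\kappa(X)}\frac{\{\sqrt q+\sqrt{r(X_k)}\}\sum_{j=r_k+1}^{m_k}\sigma(B_{0k},j)}{\sqrt n}\Big\}.$$ -/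

import Mathlib

open MeasureTheory ProbabilityTheory Matrix

/- Matrices carry the Frobenius norm throughout. -/
attribute [local instance] Matrix.frobeniusNormedAddCommGroup Matrix.frobeniusNormedSpace

namespace IRRR

/-- The Frobenius inner product `⟨A, B⟩ = tr(Aᵀ B)` on real matrices; it induces the Frobenius
norm. -/
@[reducible] noncomputable def frobeniusInnerProductSpace (a b : ℕ) :
    InnerProductSpace ℝ (Matrix (Fin a) (Fin b) ℝ) where
  inner A B := (Aᵀ * B).trace
  norm_sq_eq_re_inner A := by
    have h0 : 0 ≤ ∑ i, ∑ j, ‖A i j‖ ^ (2 : ℝ) := by positivity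
    rw [Matrix.frobenius_norm_def, ← Real.sqrt_eq_rpow, Real.sq_sqrt h0, Finset.sum_comm]
    simp [Matrix.trace, Matrix.mul_apply, pow_two]
  conj_inner_symm A B := by
    have h : (Bᵀ * A).trace = (Aᵀ * B).trace := by
      rw [← Matrix.trace_transpose, Matrix.transpose_mul, Matrix.transpose_transpose]
    simpa using h
  add_left A B C := by
    simp [Matrix.add_mul]
  smul_left A B c := by
    simp

attribute [local instance] frobeniusInnerProductSpace

/-- `σ(A, l)`: the `l`-th largest singular value of `A`, `l = 1, 2, …`
(zero if `l` exceeds the number of columns). -/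
noncomputable def sigma {a b : ℕ} (A : Matrix (Fin a) (Fin b) ℝ) (l : ℕ) : ℝ :=
  (Matrix.toEuclideanLin A).singularValues (l - 1)

/-- The nuclear norm `‖A‖⋆ = ∑_{j=1}^{a ∧ b} σ(A, j)`. -/
noncomputable def nuclearNorm {a b : ℕ} (A : Matrix (Fin a) (Fin b) ℝ) : ℝ :=
  ∑ j ∈ Finset.Icc 1 (min a b), sigma A j

/-- `Λ(Z, l)`: the `l`-th largest eigenvalue (`l = 1, …, a`, with multiplicity) of a symmetric
`a × a` matrix; the value is `0` for `l > a`. -/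
noncomputable def eigLambda {a : ℕ} (Z : Matrix (Fin a) (Fin a) ℝ) (hZ : Z.IsHermitian)
    (l : ℕ) : ℝ :=
  if h : l - 1 < Fintype.card (Fin a) then hZ.eigenvalues₀ ⟨l - 1, h⟩ else 0

/-- The Gram matrix `Z = Aᵀ A / n` of a matrix `A` with `n` rows. -/
noncomputable def gram {n a : ℕ} (A : Matrix (Fin n) (Fin a) ℝ) : Matrix (Fin a) (Fin a) ℝ :=
  (1 / (n : ℝ)) • (Aᵀ * A)

theorem gram_isHermitian {n a : ℕ} (A : Matrix (Fin n) (Fin a) ℝ) : (gram A).IsHermitian := by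
  ext i j
  simp [gram, Matrix.mul_apply, mul_comm]

/-- The view `X_k` (a block of columns) of the design matrix `X = (X_1, …, X_K)`. -/
def view {n K : ℕ} {p : Fin K → ℕ} (X : Matrix (Fin n) (Σ k, Fin (p k)) ℝ) (k : Fin K) :
    Matrix (Fin n) (Fin (p k)) ℝ :=
  X.submatrix id (fun i => ⟨k, i⟩)

/-- The block of rows `B_k` of a coefficient matrix `B = (B_1ᵀ, …, B_Kᵀ)ᵀ`. -/
def block {K q : ℕ} {p : Fin K → ℕ} (B : Matrix (Σ k, Fin (p k)) (Fin q) ℝ) (k : Fin K) :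
    Matrix (Fin (p k)) (Fin q) ℝ :=
  B.submatrix (fun i => ⟨k, i⟩) id

/-- The weight `w_k = σ(X_k, 1) {√q + √r(X_k)} / n`. -/
noncomputable def weight {n K : ℕ} {p : Fin K → ℕ} (q : ℕ)
    (X : Matrix (Fin n) (Σ k, Fin (p k)) ℝ) (k : Fin K) : ℝ :=
  sigma (view X k) 1 * (√(q : ℝ) + √((view X k).rank : ℝ)) / n

/-- The objective function
`(2n)⁻¹ ‖Y - X B‖_F² + λ ∑_k w_k ‖B_k‖⋆`. -/
noncomputable def objective {n K q : ℕ} {p : Fin K → ℕ}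
    (X : Matrix (Fin n) (Σ k, Fin (p k)) ℝ) (Y : Matrix (Fin n) (Fin q) ℝ) (lam : ℝ)
    (B : Matrix (Σ k, Fin (p k)) (Fin q) ℝ) : ℝ :=
  1 / (2 * (n : ℝ)) * ‖Y - X * B‖ ^ 2 + lam * ∑ k, weight q X k * nuclearNorm (block B k)

/-- `B` is an iRRR estimate: a minimizer of the objective function. -/
def IsEstimate {n K q : ℕ} {p : Fin K → ℕ}
    (X : Matrix (Fin n) (Σ k, Fin (p k)) ℝ) (Y : Matrix (Fin n) (Fin q) ℝ) (lam : ℝ)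
    (B : Matrix (Σ k, Fin (p k)) (Fin q) ℝ) : Prop :=
  IsMinOn (objective X Y lam) Set.univ B

/-- `A = U D Vᵀ` is a full singular value decomposition, with the singular values on the diagonal
of the rectangular matrix `D` in decreasing order. -/
def IsFullSVD {a b : ℕ} (A : Matrix (Fin a) (Fin b) ℝ) (U : Matrix (Fin a) (Fin a) ℝ)
    (V : Matrix (Fin b) (Fin b) ℝ) : Prop :=
  Uᵀ * U = 1 ∧ Vᵀ * V = 1 ∧
    A = U * Matrix.of (fun (i : Fin a) (j : Fin b) =>
      if (i : ℕ) = (j : ℕ) then sigma A ((i : ℕ) + 1) else 0) * Vᵀ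

/-- The subspace `ℬ(U^r, V^r)` of the matrices `Δ` whose row space is orthogonal to the first `r`
columns of `V` and whose column space is orthogonal to the first `r` columns of `U`. -/
def subspaceB {a b : ℕ} (U : Matrix (Fin a) (Fin a) ℝ) (V : Matrix (Fin b) (Fin b) ℝ) (r : ℕ) :
    Submodule ℝ (Matrix (Fin a) (Fin b) ℝ) where
  carrier := {D | (∀ i, ∀ j : Fin b, (j : ℕ) < r → D.row i ⬝ᵥ V.col j = 0) ∧
    (∀ j, ∀ i : Fin a, (i : ℕ) < r → D.col j ⬝ᵥ U.col i = 0)}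
  zero_mem' := by simp [Matrix.row, Matrix.col, dotProduct]
  add_mem' := by
    rintro D D' ⟨h1, h2⟩ ⟨h1', h2'⟩
    refine ⟨fun i j hj => ?_, fun j i hi => ?_⟩
    · have e : (D + D').row i = D.row i + D'.row i := rfl
      rw [e, add_dotProduct, h1 i j hj, h1' i j hj, add_zero]
    · have e : (D + D').col j = D.col j + D'.col j := rfl
      rw [e, add_dotProduct, h2 j i hi, h2' j i hi, add_zero]
  smul_mem' := by
    rintro c D ⟨h1, h2⟩
    refine ⟨fun i j hj => ?_, fun j i hi => ?_⟩
    · have e : (c • D).row i = c • D.row i := rfl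
      rw [e, smul_dotProduct, h1 i j hj, smul_zero]
    · have e : (c • D).col j = c • D.col j := rfl
      rw [e, smul_dotProduct, h2 j i hi, smul_zero]

/-- `Δ''`: the orthogonal projection of `Δ` onto `ℬ(U^r, V^r)` for the Frobenius inner product. -/
noncomputable def projB {a b : ℕ} (U : Matrix (Fin a) (Fin a) ℝ) (V : Matrix (Fin b) (Fin b) ℝ)
    (r : ℕ) (D : Matrix (Fin a) (Fin b) ℝ) : Matrix (Fin a) (Fin b) ℝ :=
  (subspaceB U V r).starProjection D

/-- `∑_{j = r+1}^{a ∧ b} σ(A, j)`. -/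
noncomputable def tailSum {a b : ℕ} (A : Matrix (Fin a) (Fin b) ℝ) (r : ℕ) : ℝ :=
  ∑ j ∈ Finset.Icc (r + 1) (min a b), sigma A j

/-- The restricted set `𝒞(r_1, …, r_K; δ)`. -/
def restrictedSet {n K q : ℕ} {p : Fin K → ℕ}
    (X : Matrix (Fin n) (Σ k, Fin (p k)) ℝ) (B₀ : Matrix (Σ k, Fin (p k)) (Fin q) ℝ)
    (U : ∀ k, Matrix (Fin (p k)) (Fin (p k)) ℝ) (V : Fin K → Matrix (Fin q) (Fin q) ℝ)
    (r : Fin K → ℕ) (δ : ℝ) : Set (Matrix (Σ k, Fin (p k)) (Fin q) ℝ) :=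
  {D | δ ≤ ‖D‖ ∧
    ∑ k, weight q X k * nuclearNorm (projB (U k) (V k) (r k) (block D k)) ≤
      ∑ k, (3 * weight q X k *
          nuclearNorm (block D k - projB (U k) (V k) (r k) (block D k)) +
        4 * weight q X k * tailSum (block B₀ k) (r k))}

/-- `X` satisfies the restricted eigenvalue condition over the set `S` with parameter `κ`. -/
def RestrictedEigenvalue {n K q : ℕ} {p : Fin K → ℕ}
    (X : Matrix (Fin n) (Σ k, Fin (p k)) ℝ) (S : Set (Matrix (Σ k, Fin (p k)) (Fin q) ℝ))
    (κ : ℝ) : Prop :=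
  0 < κ ∧ ∀ D ∈ S, κ * ‖D‖ ^ 2 ≤ 1 / (2 * (n : ℝ)) * ‖X * D‖ ^ 2

end IRRR

attribute [local instance] IRRR.frobeniusInnerProductSpace

/-! The proof combines a deterministic inequality on a noise event with a tail bound for that event.

Deterministic part. Put `Δ = Bhat - B₀`. Minimality gives `‖XΔ‖²/(2n) ≤ ⟨E, XΔ⟩/n + λ ∑ w_k (‖B₀ₖ‖⋆
- ‖B₀ₖ + Δₖ‖⋆)`. If every `X_kᵀE` has operator norm at most `nλw_k/2`, duality of nuclear and
operator norms bounds the noise term by `(λ/2) ∑ w_k (‖Δₖ'‖⋆ + ‖Δₖ''‖⋆)`. Testing `B₀ₖ + Δₖ` against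
a contraction that is the identity on the leading singular directions of `B₀ₖ` and norms `Δₖ''` on
the others bounds each penalty difference by `2 tail + ‖Δₖ'‖⋆ - ‖Δₖ''‖⋆`
(`nuclearNorm_sub_nuclearNorm_add_le`). The total, `(λ/2) ∑ w_k (3‖Δₖ'‖⋆ + 4 tail - ‖Δₖ''‖⋆)`,
dominates a square: hence `Δ` satisfies the cone inequality, and if `‖Δ‖ ≥ δ` the same quantity
bounds `κ‖Δ‖²`. Since `‖Δₖ'‖⋆ ≤ √(2r_k) ‖Δₖ‖` (`nuclearNorm_sub_projB_le`), Young's inequality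
absorbs half of `κ‖Δ‖²`, which gives `norm_sq_sub_le`.

Probabilistic part. For standard Gaussian noise the supremum of `uᵀEv`, with `u` in the unit ball of
the column space of `X_k` and `v` a unit vector, must exceed `√r(X_k) + √q + t` with probability at
most `exp(-t²/2)`. Chevet's comparison sets `uᵀEv` against `u·g + v·h` with independent Gaussian
`g`, `h` in dimensions `r(X_k)` and `q`: the covariances differ by `1 - (1 - u·u')(1 - v·v')`, which
is at most `1` and equals `1` on the diagonal. Kahane interpolation, applied to a smoothed `exp(s
max)`, turns this into a gain of `exp(-s²/2)` in the exponential moment (`integral_softExpMax_le`).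
The moments of `s‖g‖` and `s‖h‖` cost `exp(s√r + s²/2)` and `exp(s√q + s²/2)`, so Markov's
inequality at `s = t` gives the tail with no separate concentration theorem. The choice `t = θ(√q +
√r(X_k))` matches `λ`, and a union bound over `k` finishes. -/

namespace IRRR

open Real

/-! ### Gaussian integration by parts and Gaussian exponential moments. -/

section GaussianIntegration

/-- **Gaussian integration by parts** on the line. -/
theorem integral_id_mul_gaussianReal {f f' : ℝ → ℝ} (hf : ∀ x, HasDerivAt f (f' x) x)
    (hi : Integrable f (gaussianReal 0 1)) (hi' : Integrable f' (gaussianReal 0 1))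
    (hxi : Integrable (fun x => x * f x) (gaussianReal 0 1)) :
    ∫ x, x * f x ∂gaussianReal 0 1 = ∫ x, f' x ∂gaussianReal 0 1 := by
  set φ : ℝ → ℝ := gaussianPDFReal 0 1 with hφ
  have hφ' : ∀ x, HasDerivAt φ (-x * φ x) x := by
    intro x
    have h1 : HasDerivAt (fun y : ℝ => -(y - 0) ^ 2 / (2 * ((1 : NNReal) : ℝ))) (-x) x := by
      have := ((((hasDerivAt_id x).sub_const 0).pow 2).neg).div_const (2 * ((1 : NNReal) : ℝ))
      convert! this using 1
      simp
      ring
    have h2 := h1.exp.const_mul (√(2 * π * ((1 : NNReal) : ℝ)))⁻¹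
    convert! h2 using 1
    simp only [hφ, gaussianPDFReal]
    ring
  have key : ∀ g : ℝ → ℝ, Integrable g (gaussianReal 0 1) → Integrable (fun x => φ x * g x) := by
    intro g hg
    rw [gaussianReal_of_var_ne_zero 0 one_ne_zero,
      integrable_withDensity_iff_integrable_smul' (measurable_gaussianPDF 0 1)
      (ae_of_all _ fun x => gaussianPDF_lt_top)] at hg
    simpa [toReal_gaussianPDF, hφ] using hg
  have h := integral_mul_deriv_eq_deriv_mul_of_integrable (u := f) (v := φ) (u' := f')
    (v' := fun x => -x * φ x) (fun x _ => hf x) (fun x _ => hφ' x)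
    (by
      refine (key _ hxi).neg.congr (ae_of_all _ fun x => ?_)
      simp only [Pi.neg_apply, Pi.mul_apply]; ring)
    (by
      refine (key _ hi').congr (ae_of_all _ fun x => ?_)
      simp only [Pi.mul_apply]; ring)
    (by
      refine (key _ hi).congr (ae_of_all _ fun x => ?_)
      simp only [Pi.mul_apply]; ring)
  rw [integral_gaussianReal_eq_integral_smul one_ne_zero,
    integral_gaussianReal_eq_integral_smul one_ne_zero]
  have e1 : ∫ x, gaussianPDFReal 0 1 x • (x * f x) = -∫ x, f x * (-x * φ x) := by
    rw [← integral_neg]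
    refine integral_congr_ae (ae_of_all _ fun x => ?_)
    simp only [smul_eq_mul, hφ]; ring
  rw [e1, h, neg_neg]
  refine integral_congr_ae (ae_of_all _ fun x => ?_)
  simp only [smul_eq_mul, hφ]; ring

variable {ι : Type*} [Fintype ι]

/-- The standard Gaussian measure on `ι → ℝ`. -/
noncomputable abbrev stdGaussianPi (ι : Type*) [Fintype ι] : Measure (ι → ℝ) :=
  Measure.pi fun _ => gaussianReal 0 1

/-- Resampling one coordinate independently leaves a product measure unchanged. With Fubini this
reduces integration by parts in the coordinate `k` to the line. -/
theorem measurePreserving_update [DecidableEq ι] (k : ι) :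
    MeasurePreserving (fun z : (ι → ℝ) × ℝ => Function.update z.1 k z.2)
      ((stdGaussianPi ι).prod (gaussianReal 0 1)) (stdGaussianPi ι) := by
  have hm : Measurable (fun z : (ι → ℝ) × ℝ => Function.update z.1 k z.2) := by
    refine measurable_pi_lambda _ fun i => ?_
    by_cases h : i = k
    · subst h; simpa using measurable_snd
    · simp only [Function.update_of_ne h]
      fun_prop
  refine ⟨hm, (Measure.pi_eq fun s hs => ?_).symm⟩
  rw [Measure.map_apply hm (MeasurableSet.univ_pi hs)]
  have e : (fun z : (ι → ℝ) × ℝ => Function.update z.1 k z.2) ⁻¹' Set.univ.pi s =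
      (Set.univ.pi (Function.update s k Set.univ)) ×ˢ s k := by
    ext ⟨w, x⟩
    simp only [Set.mem_preimage, Set.mem_pi, Set.mem_univ, true_implies, Set.mem_prod]
    constructor
    · intro h
      refine ⟨fun i => ?_, by simpa using h k⟩
      by_cases hi : i = k
      · subst hi; simp
      · simpa [Function.update_of_ne hi] using h i
    · rintro ⟨h1, h2⟩ i
      by_cases hi : i = k
      · subst hi; simpa using h2
      · simpa [Function.update_of_ne hi] using h1 i
  rw [e, Measure.prod_prod, Measure.pi_pi, mul_comm,
    ← Finset.mul_prod_erase Finset.univ _ (Finset.mem_univ k),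
    ← Finset.mul_prod_erase Finset.univ (fun i => gaussianReal 0 1 (s i)) (Finset.mem_univ k)]
  simp only [Function.update_self, measure_univ, one_mul]
  congr 1
  refine Finset.prod_congr rfl fun i hi => ?_
  rw [Function.update_of_ne (Finset.ne_of_mem_erase hi)]

/-- **Gaussian integration by parts** in the coordinate `k`. -/
theorem integral_apply_mul_stdGaussianPi [DecidableEq ι] (k : ι) {H H' : (ι → ℝ) → ℝ}
    (hd : ∀ w x, HasDerivAt (fun y => H (Function.update w k y)) (H' (Function.update w k x)) x)
    (hi : Integrable H (stdGaussianPi ι)) (hi' : Integrable H' (stdGaussianPi ι))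
    (hxi : Integrable (fun w => w k * H w) (stdGaussianPi ι)) :
    ∫ w, w k * H w ∂stdGaussianPi ι = ∫ w, H' w ∂stdGaussianPi ι := by
  have mp := measurePreserving_update (ι := ι) k
  have fub : ∀ G : (ι → ℝ) → ℝ, Integrable G (stdGaussianPi ι) →
      Integrable (fun z : (ι → ℝ) × ℝ => G (Function.update z.1 k z.2))
        ((stdGaussianPi ι).prod (gaussianReal 0 1)) ∧
      ∫ w, G w ∂stdGaussianPi ι =
        ∫ w, ∫ x, G (Function.update w k x) ∂gaussianReal 0 1 ∂stdGaussianPi ι := by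
    intro G hG
    have h1 : Integrable (fun z : (ι → ℝ) × ℝ => G (Function.update z.1 k z.2))
        ((stdGaussianPi ι).prod (gaussianReal 0 1)) := mp.integrable_comp_of_integrable hG
    refine ⟨h1, ?_⟩
    rw [← integral_prod _ h1]
    conv_lhs => rw [← mp.map_eq]
    rw [integral_map mp.measurable.aemeasurable (by rw [mp.map_eq]; exact hG.1)]
  rw [(fub _ hxi).2, (fub _ hi').2]
  refine integral_congr_ae ?_
  filter_upwards [(fub _ hi).1.prod_right_ae, (fub _ hi').1.prod_right_ae,
    (fub _ hxi).1.prod_right_ae] with w h1 h2 h3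
  simp only [Function.update_self] at h3 ⊢
  exact integral_id_mul_gaussianReal (hd w) h1 h2 h3

theorem integrable_exp_abs_gaussianReal (M : ℝ) :
    Integrable (fun x => exp (M * |x|)) (gaussianReal 0 1) := by
  refine ((integrable_exp_mul_gaussianReal M).add (integrable_exp_mul_gaussianReal (-M))).mono'
    (by fun_prop) (ae_of_all _ fun x => ?_)
  rw [Real.norm_of_nonneg (exp_pos _).le, Pi.add_apply]
  rcases abs_cases x with ⟨h, _⟩ | ⟨h, _⟩
  · rw [h]; linarith [exp_pos (-M * x)]
  · rw [h, mul_neg, ← neg_mul]; linarith [exp_pos (M * x)]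

/-- The common dominating function: all integrands of the interpolation grow at most exponentially
in `∑ |w k|`, and its exponential factors over coordinates. -/
theorem integrable_exp_sum_abs (C M : ℝ) :
    Integrable (fun w : ι → ℝ => C * exp (M * ∑ k, |w k|)) (stdGaussianPi ι) := by
  refine Integrable.const_mul ?_ C
  have h := Integrable.fintype_prod (ι := ι) (f := fun _ x => exp (M * |x|))
    (μ := fun _ => gaussianReal 0 1) fun _ => integrable_exp_abs_gaussianReal M
  simpa only [Finset.mul_sum, exp_sum] using h

theorem integrable_of_norm_le_exp {f : (ι → ℝ) → ℝ} (hf : Continuous f) {C M : ℝ}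
    (hb : ∀ w, |f w| ≤ C * exp (M * ∑ k, |w k|)) : Integrable f (stdGaussianPi ι) :=
  (integrable_exp_sum_abs C M).mono' hf.aestronglyMeasurable (ae_of_all _ hb)

theorem integrable_exp_mul_sq_gaussianReal {α : ℝ} (hα : α < 1 / 2) :
    Integrable (fun x => exp (α * x ^ 2)) (gaussianReal 0 1) := by
  rw [gaussianReal_of_var_ne_zero 0 one_ne_zero,
    integrable_withDensity_iff_integrable_smul' (measurable_gaussianPDF 0 1)
    (ae_of_all _ fun x => gaussianPDF_lt_top)]
  refine ((integrable_exp_neg_mul_sq (b := 1 / 2 - α) (by linarith)).const_mul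
    (√(2 * π))⁻¹).congr (ae_of_all _ fun x => ?_)
  simp only [toReal_gaussianPDF, gaussianPDFReal, smul_eq_mul, NNReal.coe_one, mul_one]
  rw [mul_assoc, ← exp_add]
  ring_nf

theorem integral_exp_mul_sq_gaussianReal {α : ℝ} (hα : α < 1 / 2) :
    ∫ x, exp (α * x ^ 2) ∂gaussianReal 0 1 = (√(1 - 2 * α))⁻¹ := by
  rw [integral_gaussianReal_eq_integral_smul one_ne_zero]
  have e : ∀ x : ℝ, gaussianPDFReal 0 1 x • exp (α * x ^ 2) =
      (√(2 * π))⁻¹ * exp (-(1 / 2 - α) * x ^ 2) := by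
    intro x
    simp only [gaussianPDFReal, smul_eq_mul, NNReal.coe_one, mul_one]
    rw [mul_assoc, ← exp_add]
    ring_nf
  simp only [e]
  rw [integral_const_mul, integral_gaussian, ← sqrt_inv, ← sqrt_inv,
    ← sqrt_mul (by positivity)]
  congr 1
  have : (1 : ℝ) - 2 * α ≠ 0 := by linarith
  have h2 : (1 : ℝ) / 2 - α ≠ 0 := by linarith
  field_simp

end GaussianIntegration

/-! ### A smooth surrogate for the exponential of a maximum. -/

section SoftMax

variable {I : Type*} [Fintype I]

noncomputable def expSum (β : ℝ) (x : I → ℝ) : ℝ := ∑ i, exp (β * x i)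

/-- The smooth surrogate `(∑ i, exp (β x i)) ^ (s / β)` of `exp (s * max x)`. -/
noncomputable def softExpMax (β s : ℝ) (x : I → ℝ) : ℝ := expSum β x ^ (s / β)

/-- The Gibbs weights `exp (β x i) / ∑ j, exp (β x j)`. -/
noncomputable def gibbs (β : ℝ) (x : I → ℝ) (i : I) : ℝ := exp (β * x i) / expSum β x

theorem continuous_expSum (β : ℝ) : Continuous (expSum β : (I → ℝ) → ℝ) := by
  unfold expSum; fun_prop

theorem exp_le_softExpMax {β s : ℝ} (hβ : 0 < β) (hs : 0 ≤ s) (x : I → ℝ) (i : I) :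
    exp (s * x i) ≤ softExpMax β s x := by
  have h : exp (β * x i) ≤ expSum β x :=
    Finset.single_le_sum (f := fun i => exp (β * x i)) (fun _ _ => (exp_pos _).le)
      (Finset.mem_univ i)
  have := rpow_le_rpow (exp_pos _).le h (by positivity : 0 ≤ s / β)
  rw [← exp_mul] at this
  have e : β * x i * (s / β) = s * x i := by field_simp
  rwa [e] at this

variable [Nonempty I]

theorem expSum_pos (β : ℝ) (x : I → ℝ) : 0 < expSum β x :=
  Finset.sum_pos (fun _ _ => exp_pos _) Finset.univ_nonempty

theorem softExpMax_pos (β s : ℝ) (x : I → ℝ) : 0 < softExpMax β s x :=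
  rpow_pos_of_pos (expSum_pos β x) _

theorem gibbs_nonneg (β : ℝ) (x : I → ℝ) (i : I) : 0 ≤ gibbs β x i :=
  div_nonneg (exp_pos _).le (expSum_pos β x).le

theorem sum_gibbs (β : ℝ) (x : I → ℝ) : ∑ i, gibbs β x i = 1 := by
  simp only [gibbs, ← Finset.sum_div]
  exact div_self (expSum_pos β x).ne'

theorem gibbs_le_one (β : ℝ) (x : I → ℝ) (i : I) : gibbs β x i ≤ 1 := by
  rw [← sum_gibbs β x]
  exact Finset.single_le_sum (fun j _ => gibbs_nonneg β x j) (Finset.mem_univ i)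

theorem hasDerivAt_expSum {β t : ℝ} {x : ℝ → I → ℝ} {x' : I → ℝ}
    (hx : ∀ i, HasDerivAt (fun t => x t i) (x' i) t) :
    HasDerivAt (fun t => expSum β (x t)) (expSum β (x t) * (β * ∑ i, gibbs β (x t) i * x' i)) t := by
  have h := HasDerivAt.fun_sum (u := Finset.univ) fun i (_ : i ∈ Finset.univ) =>
    ((hx i).const_mul β).exp
  convert! h using 1
  rw [Finset.mul_sum, Finset.mul_sum]
  refine Finset.sum_congr rfl fun i _ => ?_
  have := (expSum_pos β (x t)).ne'
  rw [gibbs]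
  field_simp

theorem hasDerivAt_softExpMax {β s t : ℝ} (hβ : β ≠ 0) {x : ℝ → I → ℝ} {x' : I → ℝ}
    (hx : ∀ i, HasDerivAt (fun t => x t i) (x' i) t) :
    HasDerivAt (fun t => softExpMax β s (x t))
      (s * (softExpMax β s (x t) * ∑ i, gibbs β (x t) i * x' i)) t := by
  have h := (hasDerivAt_expSum (β := β) hx).rpow_const (p := s / β)
    (Or.inl (expSum_pos β (x t)).ne')
  convert! h using 1
  have h1 : expSum β (x t) ^ (s / β - 1) = softExpMax β s (x t) / expSum β (x t) := by
    rw [rpow_sub_one (expSum_pos β (x t)).ne', softExpMax]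
  have := (expSum_pos β (x t)).ne'
  rw [h1]
  field_simp

/-- Logarithmic derivatives add. Writing `m` for the Gibbs mean of `x'`, the surrogate contributes
`s * m` and the weight contributes `β * (x' i - m)`. -/
theorem hasDerivAt_softExpMax_mul_gibbs {β s t : ℝ} (hβ : β ≠ 0) {x : ℝ → I → ℝ} {x' : I → ℝ}
    (hx : ∀ i, HasDerivAt (fun t => x t i) (x' i) t) (i : I) :
    HasDerivAt (fun t => softExpMax β s (x t) * gibbs β (x t) i)
      (softExpMax β s (x t) * gibbs β (x t) i *
        (β * x' i - (β - s) * ∑ j, gibbs β (x t) j * x' j)) t := by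
  have h1 : HasDerivAt (fun t => gibbs β (x t) i)
      (gibbs β (x t) i * (β * x' i - β * ∑ j, gibbs β (x t) j * x' j)) t := by
    have h := ((hx i).const_mul β).exp.div (hasDerivAt_expSum (β := β) hx)
      (expSum_pos β (x t)).ne'
    convert! h using 1
    have := (expSum_pos β (x t)).ne'
    generalize ∑ j, gibbs β (x t) j * x' j = m
    rw [gibbs]
    field_simp
  convert! (hasDerivAt_softExpMax hβ hx).mul h1 using 1
  ring

theorem continuous_softExpMax (β s : ℝ) : Continuous (softExpMax β s : (I → ℝ) → ℝ) :=
  (continuous_expSum β).rpow_const fun x => Or.inl (expSum_pos β x).ne'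

theorem continuous_gibbs (β : ℝ) (i : I) : Continuous fun x : I → ℝ => gibbs β x i :=
  (by fun_prop : Continuous fun x : I → ℝ => exp (β * x i)).div (continuous_expSum β)
    fun x => (expSum_pos β x).ne'

/-- The price of smoothing: the factor `card I ^ (s / β)` tends to `1` as `β → ∞`, so the final
bound does not depend on the number of points. -/
theorem softExpMax_le {β s m : ℝ} (hβ : 0 < β) (hs : 0 < s) {x : I → ℝ}
    (hx : ∀ i, exp (s * x i) ≤ m) :
    softExpMax β s x ≤ (Fintype.card I : ℝ) ^ (s / β) * m := by
  have hm : 0 < m := (exp_pos _).trans_le (hx (Classical.arbitrary I))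
  have h1 : expSum β x ≤ Fintype.card I * m ^ (β / s) := by
    have : ∀ i ∈ Finset.univ, exp (β * x i) ≤ m ^ (β / s) := by
      intro i _
      have := rpow_le_rpow (exp_pos _).le (hx i) (by positivity : 0 ≤ β / s)
      rw [← exp_mul] at this
      convert this using 2
      field_simp
    simpa [expSum] using Finset.sum_le_card_nsmul _ _ _ this
  have h2 := rpow_le_rpow (expSum_pos β x).le h1 (by positivity : 0 ≤ s / β)
  rw [mul_rpow (by positivity) (by positivity), ← rpow_mul hm.le] at h2
  have e : β / s * (s / β) = 1 := by field_simp
  rwa [e, rpow_one] at h2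

end SoftMax

/-! ### Integrability and integration by parts for the smooth maximum of a Gaussian process. -/

section Comparison

variable {I ι : Type*} [Fintype I] [Fintype ι]

theorem abs_dotProduct_le_sum (c w : ι → ℝ) : |c ⬝ᵥ w| ≤ (∑ k, |c k|) * ∑ k, |w k| := by
  rw [dotProduct, Finset.sum_mul]
  refine (Finset.abs_sum_le_sum_abs _ _).trans (Finset.sum_le_sum fun k _ => ?_)
  rw [abs_mul]
  gcongr
  exact Finset.single_le_sum (f := fun k => |w k|) (fun _ _ => abs_nonneg _) (Finset.mem_univ k)

theorem sum_abs_dotProduct_le {c : I → ι → ℝ} {M : ℝ} (hM : ∑ i, ∑ k, |c i k| ≤ M) (w : ι → ℝ) :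
    ∑ i, |c i ⬝ᵥ w| ≤ M * ∑ k, |w k| := by
  have h0 : 0 ≤ ∑ k, |w k| := Finset.sum_nonneg fun _ _ => abs_nonneg _
  calc ∑ i, |c i ⬝ᵥ w| ≤ ∑ i, (∑ k, |c i k|) * ∑ k, |w k| :=
        Finset.sum_le_sum fun i _ => abs_dotProduct_le_sum _ _
    _ = (∑ i, ∑ k, |c i k|) * ∑ k, |w k| := by rw [Finset.sum_mul]
    _ ≤ _ := by gcongr

variable [Nonempty I]

theorem softExpMax_dotProduct_le {β s : ℝ} (hβ : 0 < β) (hs : 0 < s) {c : I → ι → ℝ} {M : ℝ}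
    (hM : ∑ i, ∑ k, |c i k| ≤ M) (w : ι → ℝ) :
    softExpMax β s (fun i => c i ⬝ᵥ w) ≤
      (Fintype.card I : ℝ) ^ (s / β) * exp (s * M * ∑ k, |w k|) := by
  refine softExpMax_le hβ hs fun i => exp_le_exp.2 ?_
  rw [mul_assoc]
  refine mul_le_mul_of_nonneg_left ?_ hs.le
  refine le_trans ?_ (sum_abs_dotProduct_le hM w)
  exact (le_abs_self _).trans
    (Finset.single_le_sum (f := fun i => |c i ⬝ᵥ w|) (fun _ _ => abs_nonneg _) (Finset.mem_univ i))

theorem integrable_softExpMax_mul {β s : ℝ} (hβ : 0 < β) (hs : 0 < s) (c : I → ι → ℝ)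
    {g : (ι → ℝ) → ℝ} (hg : Continuous g) {C : ℝ} (_ : 0 ≤ C)
    (hb : ∀ w, |g w| ≤ C * exp (∑ k, |w k|)) :
    Integrable (fun w => softExpMax β s (fun i => c i ⬝ᵥ w) * g w) (stdGaussianPi ι) := by
  have hc : Continuous fun w : ι → ℝ => fun i => c i ⬝ᵥ w := by
    unfold dotProduct; fun_prop
  refine integrable_of_norm_le_exp (C := (Fintype.card I : ℝ) ^ (s / β) * C)
    (M := s * (∑ i, ∑ k, |c i k|) + 1)
    (((continuous_softExpMax β s).comp hc).mul hg) fun w => ?_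
  rw [abs_mul, abs_of_pos (softExpMax_pos _ _ _)]
  calc _ ≤ _ := mul_le_mul (softExpMax_dotProduct_le hβ hs le_rfl w) (hb w) (abs_nonneg _)
        (by positivity)
    _ = _ := by rw [add_mul, exp_add, one_mul]; ring

theorem integrable_softExpMax {β s : ℝ} (hβ : 0 < β) (hs : 0 < s) (c : I → ι → ℝ) :
    Integrable (fun w => softExpMax β s (fun i => c i ⬝ᵥ w)) (stdGaussianPi ι) := by
  have h := integrable_softExpMax_mul hβ hs c (g := fun _ => 1) continuous_const zero_le_one
    (fun w => by
      rw [abs_one, one_mul]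
      exact one_le_exp (Finset.sum_nonneg fun _ _ => abs_nonneg _))
  simpa using h

theorem continuous_gibbs_dotProduct (β : ℝ) (c : I → ι → ℝ) (i : I) :
    Continuous fun w : ι → ℝ => gibbs β (fun i => c i ⬝ᵥ w) i := by
  have hc : Continuous fun w : ι → ℝ => fun i => c i ⬝ᵥ w := by
    unfold dotProduct; fun_prop
  exact (continuous_gibbs β i).comp hc

theorem sum_gibbs_mul_le (β : ℝ) (x y : I → ℝ) :
    |∑ j, gibbs β x j * y j| ≤ ∑ j, |y j| := by
  refine (Finset.abs_sum_le_sum_abs _ _).trans (Finset.sum_le_sum fun j _ => ?_)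
  rw [abs_mul, abs_of_nonneg (gibbs_nonneg _ _ _)]
  exact mul_le_of_le_one_left (abs_nonneg _) (gibbs_le_one _ _ _)

/-- Integration by parts for a Gibbs weight against a Gaussian linear form. -/
theorem integral_dotProduct_mul_softExpMax_mul_gibbs {β s : ℝ} (hβ : 0 < β) (hs : 0 < s)
    (c : I → ι → ℝ) (d : ι → ℝ) (i : I) :
    ∫ w, softExpMax β s (fun i => c i ⬝ᵥ w) * (gibbs β (fun i => c i ⬝ᵥ w) i * (d ⬝ᵥ w))
        ∂stdGaussianPi ι =
      ∫ w, softExpMax β s (fun i => c i ⬝ᵥ w) * (gibbs β (fun i => c i ⬝ᵥ w) i *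
        (β * (d ⬝ᵥ c i) - (β - s) * ∑ j, gibbs β (fun i => c i ⬝ᵥ w) j * (d ⬝ᵥ c j)))
        ∂stdGaussianPi ι := by
  classical
  have hexp : ∀ w : ι → ℝ, ∑ k, |w k| ≤ exp (∑ k, |w k|) := fun w => by
    linarith [add_one_le_exp (∑ k, |w k|)]
  have hexp1 : ∀ w : ι → ℝ, 1 ≤ exp (∑ k, |w k|) := fun w =>
    one_le_exp (Finset.sum_nonneg fun _ _ => abs_nonneg _)
  have hI1 : ∀ k, Integrable (fun w : ι → ℝ => softExpMax β s (fun i => c i ⬝ᵥ w) *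
      (gibbs β (fun i => c i ⬝ᵥ w) i * w k)) (stdGaussianPi ι) := by
    intro k
    refine integrable_softExpMax_mul hβ hs c
      ((continuous_gibbs_dotProduct β c i).mul (continuous_apply k)) zero_le_one fun w => ?_
    rw [abs_mul, abs_of_nonneg (gibbs_nonneg _ _ _), one_mul]
    refine (mul_le_of_le_one_left (abs_nonneg _) (gibbs_le_one _ _ _)).trans
      (le_trans ?_ (hexp w))
    exact Finset.single_le_sum (f := fun k => |w k|) (fun _ _ => abs_nonneg _) (Finset.mem_univ k)
  have hI2 : ∀ e : I → ℝ, Integrable (fun w : ι → ℝ => softExpMax β s (fun i => c i ⬝ᵥ w) *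
      (gibbs β (fun i => c i ⬝ᵥ w) i *
        (β * e i - (β - s) * ∑ j, gibbs β (fun i => c i ⬝ᵥ w) j * e j))) (stdGaussianPi ι) := by
    intro e
    have hcont := continuous_gibbs_dotProduct β c
    refine integrable_softExpMax_mul hβ hs c (C := |β * e i| + |β - s| * ∑ j, |e j|)
      (by fun_prop) (by positivity) fun w => ?_
    rw [abs_mul, abs_of_nonneg (gibbs_nonneg _ _ _)]
    refine (mul_le_of_le_one_left (abs_nonneg _) (gibbs_le_one _ _ _)).trans ?_
    refine le_trans ?_ (le_mul_of_one_le_right (by positivity) (hexp1 w))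
    refine (abs_sub _ _).trans ?_
    rw [abs_mul (β - s)]
    gcongr
    exact sum_gibbs_mul_le _ _ _
  -- One coordinate at a time; weighting by `d k` and summing then turns the products `d k * c j k`
  -- into the covariances `d ⬝ᵥ c j`.
  have hk : ∀ k, ∫ w, w k * (softExpMax β s (fun i => c i ⬝ᵥ w) *
      gibbs β (fun i => c i ⬝ᵥ w) i) ∂stdGaussianPi ι =
      ∫ w, softExpMax β s (fun i => c i ⬝ᵥ w) * (gibbs β (fun i => c i ⬝ᵥ w) i *
        (β * c i k - (β - s) * ∑ j, gibbs β (fun i => c i ⬝ᵥ w) j * c j k)) ∂stdGaussianPi ι := by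
    intro k
    refine integral_apply_mul_stdGaussianPi k (fun w x => ?_) ?_ (hI2 fun j => c j k) ?_
    · have hx : ∀ j, HasDerivAt (fun y => c j ⬝ᵥ Function.update w k y) (c j k) x := by
        intro j
        have e : ∀ y, c j ⬝ᵥ Function.update w k y = c j k * y + ∑ l ∈ Finset.univ.erase k,
            c j l * w l := by
          intro y
          rw [dotProduct, ← Finset.add_sum_erase _ _ (Finset.mem_univ k), Function.update_self]
          congr 1
          refine Finset.sum_congr rfl fun l hl => ?_
          rw [Function.update_of_ne (Finset.ne_of_mem_erase hl)]
        simp only [e]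
        simpa using ((hasDerivAt_id x).const_mul (c j k)).add_const
          (∑ l ∈ Finset.univ.erase k, c j l * w l)
      have h := hasDerivAt_softExpMax_mul_gibbs (s := s) hβ.ne'
        (x := fun y j => c j ⬝ᵥ Function.update w k y) hx i
      convert! h using 1
      ring
    · refine integrable_softExpMax_mul hβ hs c (continuous_gibbs_dotProduct β c i)
        zero_le_one fun w => ?_
      rw [abs_of_nonneg (gibbs_nonneg _ _ _), one_mul]
      exact (gibbs_le_one _ _ _).trans (hexp1 w)
    · refine (hI1 k).congr (ae_of_all _ fun w => ?_)
      ring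
  calc _ = ∫ w, ∑ k, d k * (w k * (softExpMax β s (fun i => c i ⬝ᵥ w) *
        gibbs β (fun i => c i ⬝ᵥ w) i)) ∂stdGaussianPi ι := by
        refine integral_congr_ae (ae_of_all _ fun w => ?_)
        simp only [dotProduct]
        rw [Finset.mul_sum, Finset.mul_sum]
        exact Finset.sum_congr rfl fun k _ => by ring
    _ = ∑ k, d k * ∫ w, softExpMax β s (fun i => c i ⬝ᵥ w) * (gibbs β (fun i => c i ⬝ᵥ w) i *
        (β * c i k - (β - s) * ∑ j, gibbs β (fun i => c i ⬝ᵥ w) j * c j k))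
        ∂stdGaussianPi ι := by
        rw [integral_finsetSum]
        · simp only [integral_const_mul, hk]
        · intro k _
          refine ((hI1 k).const_mul (d k)).congr (ae_of_all _ fun w => ?_)
          ring
    _ = _ := by
        simp only [← integral_const_mul]
        rw [← integral_finsetSum _ fun k _ => (hI2 fun j => c j k).const_mul (d k)]
        refine integral_congr_ae (ae_of_all _ fun w => ?_)
        have e : ∀ j, d ⬝ᵥ c j = ∑ k, d k * c j k := fun j => rfl
        simp only [e, Finset.mul_sum, mul_sub, Finset.sum_sub_distrib]
        congr 1
        · exact Finset.sum_congr rfl fun k _ => by ring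
        · rw [Finset.sum_comm]
          exact Finset.sum_congr rfl fun k _ => Finset.sum_congr rfl fun j _ => by ring

end Comparison

/-! ### Kahane interpolation along a rotation, and the resulting tail bound. -/

section Interpolation

variable {I ι : Type*}

/-- The path `cos t • a + sin t • b` of coefficient vectors. -/
noncomputable def rotPath (a b : I → ι → ℝ) (t : ℝ) : I → ι → ℝ :=
  fun i => cos t • a i + sin t • b i

/-- A quarter turn later the path equals its own velocity, so bounds on the path also serve for its
derivative. -/
theorem rotPath_add_pi_div_two (a b : I → ι → ℝ) (t : ℝ) (i : I) :
    rotPath a b (t + π / 2) i = -sin t • a i + cos t • b i := by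
  simp [rotPath, cos_add_pi_div_two, sin_add_pi_div_two]

theorem sum_abs_rotPath_le [Fintype I] [Fintype ι] (a b : I → ι → ℝ) (t : ℝ) :
    ∑ i, ∑ k, |rotPath a b t i k| ≤ ∑ i, ∑ k, (|a i k| + |b i k|) := by
  refine Finset.sum_le_sum fun i _ => Finset.sum_le_sum fun k _ => ?_
  simp only [rotPath, Pi.add_apply, Pi.smul_apply, smul_eq_mul]
  refine (abs_add_le _ _).trans ?_
  rw [abs_mul, abs_mul]
  exact add_le_add (mul_le_of_le_one_left (abs_nonneg _) (abs_cos_le_one t))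
    (mul_le_of_le_one_left (abs_nonneg _) (abs_sin_le_one t))

theorem hasDerivAt_rotPath_dotProduct [Fintype ι] (a b : I → ι → ℝ) (w : ι → ℝ) (i : I) (t : ℝ) :
    HasDerivAt (fun t => rotPath a b t i ⬝ᵥ w) (rotPath a b (t + π / 2) i ⬝ᵥ w) t := by
  rw [rotPath_add_pi_div_two]
  have h := ((hasDerivAt_cos t).mul_const (a i ⬝ᵥ w)).add
    ((hasDerivAt_sin t).mul_const (b i ⬝ᵥ w))
  convert! h using 1
  · funext t
    simp [rotPath, add_dotProduct, smul_dotProduct]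
  · simp [add_dotProduct, smul_dotProduct]

variable [Fintype I] [Fintype ι] [Nonempty I]

/-- Differentiation under the integral sign. The coefficient bound `M` is uniform in `t`, so one
exponential function dominates all derivatives. -/
theorem hasDerivAt_integral_softExpMax {β s : ℝ} (hβ : 0 < β) (hs : 0 < s) (a b : I → ι → ℝ)
    (t₀ : ℝ) :
    HasDerivAt (fun t => ∫ w, softExpMax β s (fun i => rotPath a b t i ⬝ᵥ w) ∂stdGaussianPi ι)
      (s * ∑ i, ∫ w, softExpMax β s (fun i => rotPath a b t₀ i ⬝ᵥ w) *
        (gibbs β (fun i => rotPath a b t₀ i ⬝ᵥ w) i * (rotPath a b (t₀ + π / 2) i ⬝ᵥ w))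
        ∂stdGaussianPi ι) t₀ := by
  set M := ∑ i, ∑ k, (|a i k| + |b i k|) with hM
  have hM0 : 0 ≤ M := by positivity
  have hI : ∀ i, Integrable (fun w => softExpMax β s (fun i => rotPath a b t₀ i ⬝ᵥ w) *
        (gibbs β (fun i => rotPath a b t₀ i ⬝ᵥ w) i * (rotPath a b (t₀ + π / 2) i ⬝ᵥ w)))
        (stdGaussianPi ι) := by
    intro i
    have hc : Continuous fun w : ι → ℝ => rotPath a b (t₀ + π / 2) i ⬝ᵥ w := by
      unfold dotProduct; fun_prop
    refine integrable_softExpMax_mul hβ hs (rotPath a b t₀) (C := M)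
      ((continuous_gibbs_dotProduct β (rotPath a b t₀) i).mul hc) hM0 fun w => ?_
    rw [abs_mul, abs_of_nonneg (gibbs_nonneg _ _ _)]
    refine (mul_le_of_le_one_left (abs_nonneg _) (gibbs_le_one _ _ _)).trans ?_
    have h1 := sum_abs_dotProduct_le (sum_abs_rotPath_le a b (t₀ + π / 2)) w
    have h2 := Finset.single_le_sum (f := fun i => |rotPath a b (t₀ + π / 2) i ⬝ᵥ w|)
      (fun _ _ => abs_nonneg _) (Finset.mem_univ i)
    have h3 : ∑ k, |w k| ≤ exp (∑ k, |w k|) := by linarith [add_one_le_exp (∑ k, |w k|)]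
    exact (h2.trans h1).trans (mul_le_mul_of_nonneg_left h3 hM0)
  have hcont : ∀ t, Continuous fun w : ι → ℝ => fun i => rotPath a b t i ⬝ᵥ w := by
    intro t; unfold dotProduct; fun_prop
  have key := hasDerivAt_integral_of_dominated_loc_of_deriv_le (μ := stdGaussianPi ι)
    (F := fun t w => softExpMax β s (fun i => rotPath a b t i ⬝ᵥ w))
    (F' := fun t w => s * (softExpMax β s (fun i => rotPath a b t i ⬝ᵥ w) *
      ∑ i, gibbs β (fun i => rotPath a b t i ⬝ᵥ w) i * (rotPath a b (t + π / 2) i ⬝ᵥ w)))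
    (x₀ := t₀) (s := Set.univ)
    (bound := fun w => s * (Fintype.card I : ℝ) ^ (s / β) * M *
      exp ((s * M + 1) * ∑ k, |w k|)) Filter.univ_mem
    (Filter.Eventually.of_forall fun t =>
      ((continuous_softExpMax β s).comp (hcont t)).aestronglyMeasurable)
    (integrable_softExpMax hβ hs _) ?_ ?_ (integrable_exp_sum_abs _ _) ?_
  · convert! key.2 using 1
    rw [integral_const_mul]
    simp only [Finset.mul_sum]
    rw [integral_finsetSum _ fun i _ => hI i, Finset.mul_sum]
  · refine Integrable.aestronglyMeasurable ?_
    simp only [Finset.mul_sum]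
    exact integrable_finsetSum _ fun i _ => (hI i).const_mul s
  · refine ae_of_all _ fun w t _ => ?_
    rw [norm_mul, norm_mul, norm_of_nonneg hs.le, norm_of_nonneg (softExpMax_pos _ _ _).le,
      Real.norm_eq_abs]
    have h1 := softExpMax_dotProduct_le hβ hs (sum_abs_rotPath_le a b t) w
    have h2 := (sum_gibbs_mul_le β (fun i => rotPath a b t i ⬝ᵥ w)
      (fun i => rotPath a b (t + π / 2) i ⬝ᵥ w)).trans
      (sum_abs_dotProduct_le (sum_abs_rotPath_le a b (t + π / 2)) w)
    have h3 : ∑ k, |w k| ≤ exp (∑ k, |w k|) := by linarith [add_one_le_exp (∑ k, |w k|)]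
    calc _ ≤ s * (((Fintype.card I : ℝ) ^ (s / β) * exp (s * M * ∑ k, |w k|)) *
          (M * exp (∑ k, |w k|))) := by
          gcongr
          exact h2.trans (mul_le_mul_of_nonneg_left h3 hM0)
      _ = _ := by rw [add_mul, exp_add, one_mul]; ring
  · exact ae_of_all _ fun w t _ => hasDerivAt_softExpMax hβ.ne'
      fun i => hasDerivAt_rotPath_dotProduct a b w i t

/-- **Kahane's comparison inequality** for the smooth maximum: the covariance of the second process
exceeds that of the first by exactly `1` on the diagonal and by at most `1` elsewhere. -/
theorem integral_softExpMax_le {β s : ℝ} (hs : 0 < s) (hsβ : s ≤ β) {a b : I → ι → ℝ}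
    (hab : ∀ i j, a i ⬝ᵥ b j = 0)
    (hdiag : ∀ i, b i ⬝ᵥ b i - a i ⬝ᵥ a i = 1)
    (hoff : ∀ i j, b i ⬝ᵥ b j - a i ⬝ᵥ a j ≤ 1) :
    ∫ w, softExpMax β s (fun i => a i ⬝ᵥ w) ∂stdGaussianPi ι ≤
      exp (-(s ^ 2 / 2)) * ∫ w, softExpMax β s (fun i => b i ⬝ᵥ w) ∂stdGaussianPi ι := by
  have hβ : 0 < β := hs.trans_le hsβ
  set φ : ℝ → ℝ := fun t => ∫ w, softExpMax β s (fun i => rotPath a b t i ⬝ᵥ w) ∂stdGaussianPi ι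
    with hφ
  -- Since `a` and `b` are orthogonal, the covariance of velocity and position is a multiple of the
  -- difference of the two covariances.
  have hcov : ∀ t i j, rotPath a b (t + π / 2) i ⬝ᵥ rotPath a b t j =
      sin t * cos t * (b i ⬝ᵥ b j - a i ⬝ᵥ a j) := by
    intro t i j
    rw [rotPath_add_pi_div_two, rotPath]
    simp only [add_dotProduct, dotProduct_add, smul_dotProduct, dotProduct_smul, smul_eq_mul, hab,
      dotProduct_comm (b i) (a j)]
    ring
  have hderiv : ∀ t, ∃ φ', HasDerivAt φ φ' t ∧
      (0 ≤ sin t * cos t → s ^ 2 * (sin t * cos t) * φ t ≤ φ') := by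
    intro t
    refine ⟨_, hasDerivAt_integral_softExpMax hβ hs a b t, fun h0 => ?_⟩
    simp only [integral_dotProduct_mul_softExpMax_mul_gibbs hβ hs, hcov]
    set z : (ι → ℝ) → I → ℝ := fun w i => rotPath a b t i ⬝ᵥ w with hz
    set d : I → I → ℝ := fun i j => b i ⬝ᵥ b j - a i ⬝ᵥ a j with hd
    have hint : ∀ i, Integrable (fun w => softExpMax β s (z w) * (gibbs β (z w) i *
        (β * (sin t * cos t * d i i) - (β - s) * ∑ j, gibbs β (z w) j *
          (sin t * cos t * d i j)))) (stdGaussianPi ι) := by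
      intro i
      have hcont := continuous_gibbs_dotProduct β (rotPath a b t)
      refine integrable_softExpMax_mul hβ hs _ (C := |β * (sin t * cos t * d i i)| +
        |β - s| * ∑ j, |sin t * cos t * d i j|) (by fun_prop) (by positivity) fun w => ?_
      rw [abs_mul, abs_of_nonneg (gibbs_nonneg _ _ _)]
      refine (mul_le_of_le_one_left (abs_nonneg _) (gibbs_le_one _ _ _)).trans ?_
      refine le_trans ?_ (le_mul_of_one_le_right (by positivity)
        (one_le_exp (Finset.sum_nonneg fun k _ => abs_nonneg (w k))))
      refine (abs_sub _ _).trans ?_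
      rw [abs_mul (β - s)]
      gcongr
      exact sum_gibbs_mul_le _ _ _
    rw [← integral_finsetSum _ fun i _ => hint i, ← integral_const_mul]
    rw [← integral_const_mul]
    refine integral_mono ((integrable_softExpMax hβ hs _).const_mul _)
      ((integrable_finsetSum _ fun i _ => hint i).const_mul s) fun w => ?_
    change s ^ 2 * (sin t * cos t) * softExpMax β s (z w) ≤ _
    -- The diagonal gives exactly `β` and the Gibbs average takes away at most `β - s`, because `s ≤
    -- β`; what is left is `s`, up to the factor `sin t * cos t`.
    have h1 : ∀ i, gibbs β (z w) i * (sin t * cos t * s) ≤ gibbs β (z w) i *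
        (β * (sin t * cos t * d i i) - (β - s) * ∑ j, gibbs β (z w) j *
          (sin t * cos t * d i j)) := by
      intro i
      refine mul_le_mul_of_nonneg_left ?_ (gibbs_nonneg _ _ _)
      have h2 : ∑ j, gibbs β (z w) j * (sin t * cos t * d i j) ≤ sin t * cos t := by
        calc _ ≤ ∑ j, gibbs β (z w) j * (sin t * cos t * 1) := by
              refine Finset.sum_le_sum fun j _ => mul_le_mul_of_nonneg_left
                (mul_le_mul_of_nonneg_left (hoff i j) h0) (gibbs_nonneg _ _ _)
          _ = _ := by rw [← Finset.sum_mul, sum_gibbs, one_mul, mul_one]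
      have h3 : d i i = 1 := hdiag i
      have h4 := mul_le_mul_of_nonneg_left h2 (sub_nonneg.2 hsβ)
      rw [h3]
      linarith
    have h5 := Finset.sum_le_sum fun i (_ : i ∈ Finset.univ) => h1 i
    rw [← Finset.sum_mul, sum_gibbs, one_mul] at h5
    rw [← Finset.mul_sum]
    have h6 := mul_le_mul_of_nonneg_left h5 (mul_nonneg hs.le (softExpMax_pos β s (z w)).le)
    linarith
  choose φ' hφ' hge using hderiv
  -- Integrating factor for `φ' ≥ s² sin t cos t φ`; its values at `0` and `π / 2` are `1` and `exp
  -- (-s² / 2)`.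
  set ψ : ℝ → ℝ := fun t => exp (-(s ^ 2 * sin t ^ 2 / 2)) * φ t with hψ
  have hψ' : ∀ t, HasDerivAt ψ (exp (-(s ^ 2 * sin t ^ 2 / 2)) *
      (φ' t - s ^ 2 * (sin t * cos t) * φ t)) t := by
    intro t
    have h1 : HasDerivAt (fun t => -(s ^ 2 * sin t ^ 2 / 2)) (-(s ^ 2 * (sin t * cos t))) t := by
      have := ((((hasDerivAt_sin t).pow 2).const_mul (s ^ 2)).div_const 2).neg
      convert! this using 1
      simp
      ring
    convert! h1.exp.mul (hφ' t) using 1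
    ring
  have hmono : MonotoneOn ψ (Set.Icc 0 (π / 2)) := by
    refine monotoneOn_of_deriv_nonneg (convex_Icc _ _)
      (fun t _ => (hψ' t).continuousAt.continuousWithinAt)
      (fun t _ => (hψ' t).differentiableAt.differentiableWithinAt) fun t ht => ?_
    rw [interior_Icc] at ht
    rw [(hψ' t).deriv]
    refine mul_nonneg (exp_pos _).le (sub_nonneg.2 (hge t ?_))
    exact mul_nonneg (sin_nonneg_of_nonneg_of_le_pi ht.1.le (by linarith [ht.2, pi_pos]))
      (cos_nonneg_of_mem_Icc ⟨by linarith [ht.1, pi_pos], ht.2.le⟩)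
  have h := hmono (Set.left_mem_Icc.2 (by positivity)) (Set.right_mem_Icc.2 (by positivity))
    (by positivity)
  simpa [hψ, hφ, rotPath] using h

/-- A tail bound for the maximum of a Gaussian process that is dominated by a second one. -/
theorem measureReal_exists_le_dotProduct_le {s : ℝ} (hs : 0 < s) {a b : I → ι → ℝ}
    (hab : ∀ i j, a i ⬝ᵥ b j = 0)
    (hdiag : ∀ i, b i ⬝ᵥ b i - a i ⬝ᵥ a i = 1)
    (hoff : ∀ i j, b i ⬝ᵥ b j - a i ⬝ᵥ a j ≤ 1)
    {g : (ι → ℝ) → ℝ} (hg : Integrable g (stdGaussianPi ι))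
    (hbg : ∀ w i, exp (s * (b i ⬝ᵥ w)) ≤ g w) (m : ℝ) :
    (stdGaussianPi ι).real {w | ∃ i, m ≤ a i ⬝ᵥ w} ≤
      exp (-(s * m) - s ^ 2 / 2) * ∫ w, g w ∂stdGaussianPi ι := by
  have hβ : ∀ β, s ≤ β → (stdGaussianPi ι).real {w | ∃ i, m ≤ a i ⬝ᵥ w} ≤
      (Fintype.card I : ℝ) ^ (s / β) *
        (exp (-(s * m) - s ^ 2 / 2) * ∫ w, g w ∂stdGaussianPi ι) := by
    intro β hsβ
    have hβ : 0 < β := hs.trans_le hsβ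
    have h1 := mul_meas_ge_le_integral_of_nonneg (μ := stdGaussianPi ι)
      (f := fun w => softExpMax β s (fun i => a i ⬝ᵥ w))
      (ae_of_all _ fun w => (softExpMax_pos _ _ _).le) (integrable_softExpMax hβ hs a)
      (exp (s * m))
    have h2 : (stdGaussianPi ι).real {w | ∃ i, m ≤ a i ⬝ᵥ w} ≤
        (stdGaussianPi ι).real {w | exp (s * m) ≤ softExpMax β s (fun i => a i ⬝ᵥ w)} := by
      refine measureReal_mono ?_
      rintro w ⟨i, hi⟩
      refine le_trans ?_ (exp_le_softExpMax hβ hs.le _ i)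
      exact exp_le_exp.2 (mul_le_mul_of_nonneg_left hi hs.le)
    have h3 := integral_softExpMax_le hs hsβ hab hdiag hoff
    have h4 : ∫ w, softExpMax β s (fun i => b i ⬝ᵥ w) ∂stdGaussianPi ι ≤
        (Fintype.card I : ℝ) ^ (s / β) * ∫ w, g w ∂stdGaussianPi ι := by
      rw [← integral_const_mul]
      exact integral_mono (integrable_softExpMax hβ hs b) (hg.const_mul _)
        fun w => softExpMax_le hβ hs (hbg w)
    have h5 := (mul_le_mul_of_nonneg_left h2 (exp_pos (s * m)).le).trans
      (h1.trans (h3.trans (mul_le_mul_of_nonneg_left h4 (exp_pos _).le)))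
    have h6 := mul_le_mul_of_nonneg_left h5 (exp_pos (-(s * m))).le
    rw [← mul_assoc, ← exp_add, neg_add_cancel, exp_zero, one_mul] at h6
    refine h6.trans (le_of_eq ?_)
    rw [sub_eq_add_neg, exp_add]
    ring
  -- The left side of `hβ` is free of `β`, so letting `β → ∞` removes the cardinality of `I`.
  have hlim : Filter.Tendsto (fun β => (Fintype.card I : ℝ) ^ (s / β) *
      (exp (-(s * m) - s ^ 2 / 2) * ∫ w, g w ∂stdGaussianPi ι)) Filter.atTop
      (nhds ((Fintype.card I : ℝ) ^ (0 : ℝ) *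
        (exp (-(s * m) - s ^ 2 / 2) * ∫ w, g w ∂stdGaussianPi ι))) := by
    refine Filter.Tendsto.mul_const _ ?_
    refine Filter.Tendsto.rpow tendsto_const_nhds (Filter.tendsto_id.const_div_atTop s)
      (Or.inl (by simp))
  rw [rpow_zero, one_mul] at hlim
  exact ge_of_tendsto hlim (Filter.eventually_atTop.2 ⟨s, hβ⟩)

end Interpolation

/-! ### Elementary inequalities for the dot product. -/

section DotProduct

variable {a : Type*} [Fintype a]

theorem dotProduct_self_nonneg_real (x : a → ℝ) : 0 ≤ x ⬝ᵥ x :=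
  Finset.sum_nonneg fun i _ => mul_self_nonneg (x i)

theorem two_mul_dotProduct_le (x y : a → ℝ) : 2 * (x ⬝ᵥ y) ≤ x ⬝ᵥ x + y ⬝ᵥ y := by
  have h := dotProduct_self_nonneg_real (x - y)
  rw [sub_dotProduct, dotProduct_sub, dotProduct_sub, dotProduct_comm y x] at h
  linarith

end DotProduct

/-! ### Chevet's inequality with a Gaussian tail. -/

section Chevet

/-- Here `log x ≤ sinh (log x) = (x - x⁻¹) / 2`, and the right side exceeds this by `(x - 1)(1 -
x⁻²) / 2 ≥ 0`. Multiplied by `r`, it is the inequality left after optimizing the exponential moment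
below. -/
theorem log_le_sub_inv_add {x : ℝ} (hx : 1 ≤ x) :
    log x ≤ x - x⁻¹ + ((x⁻¹) ^ 2 - 1) / 2 := by
  have hx0 : 0 < x := by linarith
  have h1 : log x ≤ (x - x⁻¹) / 2 := by
    rw [← sinh_log hx0]
    exact self_le_sinh_iff.2 (log_nonneg hx)
  have h2 : x⁻¹ ≤ 1 := inv_le_one_of_one_le₀ hx
  have h3 : 0 < x⁻¹ := by positivity
  have h4 : x * x⁻¹ = 1 := mul_inv_cancel₀ hx0.ne'
  have h5 : 0 ≤ (x - 1) * (1 - x⁻¹ ^ 2) := mul_nonneg (by linarith) (by nlinarith)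
  have h6 : (x - 1) * (1 - x⁻¹ ^ 2) = x - x⁻¹ - 1 + x⁻¹ ^ 2 := by
    linear_combination (-x⁻¹) * h4
  linarith

/-- The optimal linearization of the Euclidean norm in the exponential moment of a Gaussian
vector. -/
theorem exists_exp_mul_inv_sqrt_pow_le {r : ℕ} (hr : 0 < r) {s : ℝ} (hs : 0 < s) :
    ∃ c, s < c ∧ exp (s * c / 2) * (√(1 - 2 * (s / (2 * c))))⁻¹ ^ r ≤ exp (s * √r + s ^ 2 / 2) := by
  set a : ℝ := √r with ha
  have ha0 : 0 < a := sqrt_pos.2 (by exact_mod_cast hr)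
  have ha2 : a ^ 2 = r := sq_sqrt (by positivity)
  set y : ℝ := s / a with hy
  have hy0 : 0 < y := by positivity
  have hsy : s = a * y := by rw [hy]; field_simp
  -- The minimizer over `c` of the left side solves `c² - s c = r`. With `c = √r x` and `s = √r y`
  -- this reads `x² - y x = 1`, and then `1 - s / c = x⁻²`.
  set x : ℝ := (y + √(y ^ 2 + 4)) / 2 with hx
  have hsq : √(y ^ 2 + 4) ^ 2 = y ^ 2 + 4 := sq_sqrt (by positivity)
  have hx1 : 1 < x := by
    have : 2 ≤ √(y ^ 2 + 4) := le_sqrt_of_sq_le (by nlinarith)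
    rw [hx]; linarith
  have hx0 : 0 < x := by linarith
  have hxx : x ^ 2 - y * x = 1 := by rw [hx]; nlinarith
  have hyx : y = x - x⁻¹ := by field_simp; linarith
  refine ⟨a * x, ?_, ?_⟩
  · rw [hsy]
    refine mul_lt_mul_of_pos_left ?_ ha0
    rw [hyx]; linarith [inv_pos.2 hx0]
  · have e1 : 1 - 2 * (s / (2 * (a * x))) = (x⁻¹) ^ 2 := by
      rw [hsy, hyx]; field_simp; ring
    rw [e1, sqrt_sq (by positivity), inv_inv]
    have e2 : x ^ r = exp (r * log x) := by
      rw [mul_comm, exp_mul, exp_log hx0, rpow_natCast]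
    rw [e2, ← exp_add, exp_le_exp, ← ha2, hsy]
    have h := mul_le_mul_of_nonneg_left (log_le_sub_inv_add hx1.le) (sq_nonneg a)
    have h4 : x * x⁻¹ = 1 := mul_inv_cancel₀ hx0.ne'
    rw [hyx]
    have e3 : a * (x - x⁻¹) * (a * x) / 2 + a ^ 2 * (x - x⁻¹ + ((x⁻¹) ^ 2 - 1) / 2) =
      a * (x - x⁻¹) * a + (a * (x - x⁻¹)) ^ 2 / 2 := by
      linear_combination (a ^ 2 / 2) * h4
    linarith

/-- Young's inequality in each coordinate. The bound no longer involves `u`, and its exponential is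
a product over coordinates, as the norm of `g` would not be. -/
theorem mul_dotProduct_le {ι : Type*} [Fintype ι] {s c : ℝ} (hs : 0 < s) (hc : 0 < c)
    {u : ι → ℝ} (hu : u ⬝ᵥ u ≤ 1) (g : ι → ℝ) :
    s * (u ⬝ᵥ g) ≤ s * c / 2 + ∑ i, s / (2 * c) * g i ^ 2 := by
  have h : ∀ i, u i * g i ≤ c / 2 * (u i * u i) + 1 / (2 * c) * g i ^ 2 := by
    intro i
    have : c / 2 * (u i * u i) + 1 / (2 * c) * g i ^ 2 - u i * g i =
        (c * u i - g i) ^ 2 / (2 * c) := by field_simp; ring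
    have h2 : 0 ≤ (c * u i - g i) ^ 2 / (2 * c) := by positivity
    linarith
  have h1 : u ⬝ᵥ g ≤ c / 2 * (u ⬝ᵥ u) + ∑ i, 1 / (2 * c) * g i ^ 2 := by
    rw [dotProduct, dotProduct, Finset.mul_sum, ← Finset.sum_add_distrib]
    exact Finset.sum_le_sum fun i _ => h i
  have h2 : c / 2 * (u ⬝ᵥ u) ≤ c / 2 := mul_le_of_le_one_right (by positivity) hu
  calc s * (u ⬝ᵥ g) ≤ s * (c / 2 + ∑ i, 1 / (2 * c) * g i ^ 2) := by gcongr; linarith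
    _ = _ := by
      rw [mul_add, Finset.mul_sum]
      congr 1
      · ring
      · exact Finset.sum_congr rfl fun i _ => by field_simp

theorem measurePreserving_comp_inl {κ ρ : Type*} [Fintype κ] [Fintype ρ] :
    MeasurePreserving (fun (w : κ ⊕ ρ → ℝ) k => w (Sum.inl k)) (stdGaussianPi (κ ⊕ ρ))
      (stdGaussianPi κ) :=
  measurePreserving_fst.comp (measurePreserving_sumPiEquivProdPi fun _ : κ ⊕ ρ => gaussianReal 0 1)

variable {I κ ρ ν : Type*} [Fintype I] [Nonempty I] [Fintype κ] [Fintype ρ] [Fintype ν]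

/-- The upper tail of finitely many values of the bilinear form of a standard Gaussian matrix, the
left arguments being isometric to vectors indexed by `ρ`. -/
theorem measureReal_exists_le_bilinear_le [Nonempty ρ] [Nonempty ν]
    {u : I → κ → ℝ} {u' : I → ρ → ℝ} {v : I → ν → ℝ}
    (huu : ∀ i j, u' i ⬝ᵥ u' j = u i ⬝ᵥ u j) (hu : ∀ i, u i ⬝ᵥ u i ≤ 1)
    (hv : ∀ i, v i ⬝ᵥ v i = 1) {t : ℝ} (ht : 0 < t) :
    (stdGaussianPi (κ × ν)).real
        {w | ∃ i, √(Fintype.card ρ) + √(Fintype.card ν) + t ≤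
          (fun p : κ × ν => u i p.1 * v i p.2) ⬝ᵥ w} ≤ exp (-(t ^ 2 / 2)) := by
  obtain ⟨c₁, hc₁, hJ₁⟩ := exists_exp_mul_inv_sqrt_pow_le (Fintype.card_pos (α := ρ)) ht
  obtain ⟨c₂, hc₂, hJ₂⟩ := exists_exp_mul_inv_sqrt_pow_le (Fintype.card_pos (α := ν)) ht
  have hc₁0 : 0 < c₁ := ht.trans hc₁
  have hc₂0 : 0 < c₂ := ht.trans hc₂
  have hα₁ : t / (2 * c₁) < 1 / 2 := by
    rw [div_lt_div_iff₀ (by positivity) two_pos]; linarith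
  have hα₂ : t / (2 * c₂) < 1 / 2 := by
    rw [div_lt_div_iff₀ (by positivity) two_pos]; linarith
  have htens : ∀ i j, (fun p : κ × ν => u i p.1 * v i p.2) ⬝ᵥ (fun p => u j p.1 * v j p.2) =
      (u i ⬝ᵥ u j) * (v i ⬝ᵥ v j) := by
    intro i j
    simp only [dotProduct, Finset.sum_mul_sum, ← Finset.univ_product_univ, Finset.sum_product]
    exact Finset.sum_congr rfl fun _ _ => Finset.sum_congr rfl fun _ _ => by ring
  -- The two processes use disjoint coordinates, hence are independent. The second one takes `u'`
  -- instead of `u`, so that the dimension entering is `card ρ` and not `card κ`.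
  set a : I → (κ × ν) ⊕ (ρ ⊕ ν) → ℝ :=
    fun i => Sum.elim (fun p => u i p.1 * v i p.2) 0 with ha
  set b : I → (κ × ν) ⊕ (ρ ⊕ ν) → ℝ := fun i => Sum.elim 0 (Sum.elim (u' i) (v i)) with hb
  have haw : ∀ i w, a i ⬝ᵥ w =
      (fun p : κ × ν => u i p.1 * v i p.2) ⬝ᵥ (fun p => w (Sum.inl p)) := by
    intro i w
    simp [ha, dotProduct]
  have hbw : ∀ i w, b i ⬝ᵥ w =
      u' i ⬝ᵥ (fun k => w (Sum.inr (Sum.inl k))) + v i ⬝ᵥ (fun k => w (Sum.inr (Sum.inr k))) := by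
    intro i w
    simp [hb, dotProduct]
  -- The product is nonnegative by Cauchy–Schwarz and vanishes on the diagonal because the `v i` are
  -- unit vectors; the `u i` need only lie in the ball.
  have hbb : ∀ i j, b i ⬝ᵥ b j - a i ⬝ᵥ a j =
      1 - (1 - u i ⬝ᵥ u j) * (1 - v i ⬝ᵥ v j) := by
    intro i j
    rw [hbw, haw]
    simp only [ha, hb, Sum.elim_inl, Sum.elim_inr]
    rw [htens, huu]
    ring
  set f : (κ × ν) ⊕ (ρ ⊕ ν) → ℝ → ℝ := Sum.elim (fun _ _ => 1)
    (Sum.elim (fun _ x => exp (t / (2 * c₁) * x ^ 2)) (fun _ x => exp (t / (2 * c₂) * x ^ 2)))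
    with hf
  have hfi : ∀ k, Integrable (f k) (gaussianReal 0 1) := by
    rintro (k | k | k)
    · exact integrable_const _
    · exact integrable_exp_mul_sq_gaussianReal hα₁
    · exact integrable_exp_mul_sq_gaussianReal hα₂
  have hprod := Integrable.fintype_prod (μ := fun _ => gaussianReal 0 1) hfi
  have hint : ∫ w, exp (t * c₁ / 2 + t * c₂ / 2) * ∏ k, f k (w k)
      ∂stdGaussianPi ((κ × ν) ⊕ (ρ ⊕ ν)) ≤
      exp (t * √(Fintype.card ρ) + t ^ 2 / 2) * exp (t * √(Fintype.card ν) + t ^ 2 / 2) := by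
    rw [integral_const_mul, integral_fintype_prod_eq_prod f]
    simp only [Fintype.prod_sum_type, hf, Sum.elim_inl, Sum.elim_inr,
      integral_exp_mul_sq_gaussianReal hα₁, integral_exp_mul_sq_gaussianReal hα₂]
    simp only [integral_const, probReal_univ, smul_eq_mul, mul_one, Finset.prod_const_one,
      one_mul, Finset.prod_const, Finset.card_univ]
    refine le_trans (le_of_eq ?_) (mul_le_mul hJ₁ hJ₂ (by positivity) (exp_pos _).le)
    rw [exp_add]
    ring
  have key := measureReal_exists_le_dotProduct_le ht (a := a) (b := b)
    (fun i j => by rw [haw]; simp [hb, dotProduct])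
    (fun i => by rw [hbb, hv]; ring)
    (fun i j => by
      rw [hbb]
      have h1 := two_mul_dotProduct_le (u i) (u j)
      have h2 := two_mul_dotProduct_le (v i) (v j)
      have h3 : 0 ≤ (1 - u i ⬝ᵥ u j) * (1 - v i ⬝ᵥ v j) :=
        mul_nonneg (by linarith [hu i, hu j]) (by linarith [hv i, hv j])
      linarith)
    (g := fun w => exp (t * c₁ / 2 + t * c₂ / 2) * ∏ k, f k (w k)) (hprod.const_mul _)
    (fun w i => by
      rw [hbw]
      have h1 := mul_dotProduct_le ht hc₁0 ((huu i i).trans_le (hu i))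
        (fun k => w (Sum.inr (Sum.inl k)))
      have h2 := mul_dotProduct_le ht hc₂0 (hv i).le (fun k => w (Sum.inr (Sum.inr k)))
      simp only [Fintype.prod_sum_type, hf, Sum.elim_inl, Sum.elim_inr, Finset.prod_const_one,
        one_mul, ← exp_sum]
      rw [← exp_add, ← exp_add, exp_le_exp]
      linarith)
    (√(Fintype.card ρ) + √(Fintype.card ν) + t)
  have hmeas : MeasurableSet {w : κ × ν → ℝ | ∃ i, √(Fintype.card ρ) + √(Fintype.card ν) + t ≤
      (fun p : κ × ν => u i p.1 * v i p.2) ⬝ᵥ w} := by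
    rw [Set.ofPred_exists]
    refine MeasurableSet.iUnion fun i => measurableSet_le measurable_const ?_
    unfold dotProduct
    fun_prop
  rw [← (measurePreserving_comp_inl (κ := κ × ν) (ρ := ρ ⊕ ν)).measureReal_preimage
    hmeas.nullMeasurableSet]
  simp only [haw] at key
  refine key.trans ((mul_le_mul_of_nonneg_left hint (exp_pos _).le).trans (le_of_eq ?_))
  rw [← exp_add, ← exp_add]
  congr 1
  ring

end Chevet

/-! ### The noise event for one view. -/

section GaussianEvent

/-- The column space of a matrix is isometric to `Fin X.rank → ℝ` with the dot product. -/
theorem exists_isometric_coordinates {n a : ℕ} (X : Matrix (Fin n) (Fin a) ℝ) :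
    ∃ φ : (Fin a → ℝ) → Fin X.rank → ℝ, ∀ x y, φ x ⬝ᵥ φ y = (X *ᵥ x) ⬝ᵥ (X *ᵥ y) := by
  set L := LinearMap.range (Matrix.toEuclideanLin X) with hL
  have hdim : Module.finrank ℝ L = X.rank := by
    rw [hL, Matrix.rank_eq_finrank_range_toLin X (EuclideanSpace.basisFun _ ℝ).toBasis
      (EuclideanSpace.basisFun _ ℝ).toBasis, Matrix.toEuclideanLin_eq_toLin_orthonormal]
  set β := (stdOrthonormalBasis ℝ L).reindex (finCongr hdim)
  refine ⟨fun x => (β.repr ((Matrix.toEuclideanLin X).rangeRestrict (WithLp.toLp 2 x))).ofLp,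
    fun x y => ?_⟩
  have h := β.repr.inner_map_map ((Matrix.toEuclideanLin X).rangeRestrict (WithLp.toLp 2 x))
    ((Matrix.toEuclideanLin X).rangeRestrict (WithLp.toLp 2 y))
  rw [EuclideanSpace.inner_eq_star_dotProduct, Submodule.coe_inner,
    EuclideanSpace.inner_eq_star_dotProduct] at h
  rw [dotProduct_comm, dotProduct_comm (X *ᵥ x)]
  simpa using h

theorem measure_exists_nat_le_bilinear_le {n a q : ℕ} (X : Matrix (Fin n) (Fin a) ℝ)
    (hX : 0 < X.rank) (hq : 0 < q) {t : ℝ} (ht : 0 < t)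
    (z : ℕ → (Fin a → ℝ) × (Fin q → ℝ)) (hz₁ : ∀ k, (X *ᵥ (z k).1) ⬝ᵥ (X *ᵥ (z k).1) ≤ 1)
    (hz₂ : ∀ k, (z k).2 ⬝ᵥ (z k).2 = 1) :
    (stdGaussianPi (Fin n × Fin q))
      {w | ∃ k, √(X.rank : ℝ) + √(q : ℝ) + t ≤
        (fun p : Fin n × Fin q => (X *ᵥ (z k).1) p.1 * (z k).2 p.2) ⬝ᵥ w} ≤
      ENNReal.ofReal (exp (-(t ^ 2 / 2))) := by
  obtain ⟨φ, hφ⟩ := exists_isometric_coordinates X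
  have : Nonempty (Fin X.rank) := ⟨⟨0, hX⟩⟩
  have : Nonempty (Fin q) := ⟨⟨0, hq⟩⟩
  set T : ℕ → Set (Fin n × Fin q → ℝ) := fun N => {w | ∃ k : Fin (N + 1),
    √(X.rank : ℝ) + √(q : ℝ) + t ≤
        (fun p : Fin n × Fin q => (X *ᵥ (z k).1) p.1 * (z k).2 p.2) ⬝ᵥ w} with hT
  have hmono : Monotone T := by
    rintro N M hNM w ⟨k, hk⟩
    exact ⟨⟨k, by omega⟩, hk⟩
  have hU : {w | ∃ k, √(X.rank : ℝ) + √(q : ℝ) + t ≤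
        (fun p : Fin n × Fin q => (X *ᵥ (z k).1) p.1 * (z k).2 p.2) ⬝ᵥ w} = ⋃ N, T N := by
    ext w
    simp only [hT, Set.mem_iUnion, Set.mem_ofPred_eq]
    exact ⟨fun ⟨k, hk⟩ => ⟨k, ⟨k, by omega⟩, hk⟩, fun ⟨_, k, hk⟩ => ⟨k, hk⟩⟩
  rw [hU, hmono.measure_iUnion]
  refine iSup_le fun N => ?_
  have h := measureReal_exists_le_bilinear_le (I := Fin (N + 1))
    (u := fun k => X *ᵥ (z k).1) (u' := fun k => φ (z k).1) (v := fun k => (z k).2)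
    (fun i j => hφ _ _) (fun i => hz₁ i) (fun i => hz₂ i) ht
  rw [Fintype.card_fin, Fintype.card_fin] at h
  rw [← ofReal_measureReal]
  exact ENNReal.ofReal_le_ofReal h

/-- The noise event for one view: all values of the bilinear form of the noise matrix on the unit
ball of the column space of `X` and the unit sphere are controlled. -/
theorem exists_measurableSet_bilinear_le {n a q : ℕ} (X : Matrix (Fin n) (Fin a) ℝ)
    {Ω : Type*} {mΩ : MeasurableSpace Ω} {P : Measure Ω} [IsProbabilityMeasure P]
    {τ : ℝ} (hτ : 0 < τ) {E : Ω → Matrix (Fin n) (Fin q) ℝ}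
    (hlaw : ∀ i j, HasLaw (fun ω => E ω i j) (gaussianReal 0 (τ ^ 2).toNNReal) P)
    (hindep : iIndepFun (fun (ij : Fin n × Fin q) (ω : Ω) => E ω ij.1 ij.2) P)
    {t : ℝ} (ht : 0 < t) :
    ∃ A : Set Ω, MeasurableSet A ∧ 1 - exp (-(t ^ 2 / 2)) ≤ P.real A ∧
      ∀ ω ∈ A, ∀ x v, (X *ᵥ x) ⬝ᵥ (X *ᵥ x) ≤ 1 → v ⬝ᵥ v = 1 →
        (X *ᵥ x) ⬝ᵥ (E ω *ᵥ v) ≤ τ * (√(X.rank : ℝ) + √(q : ℝ) + t) := by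
  -- Disposes of `q = 0` and of rank zero, where the comparison vectors have no coordinates.
  have htriv : (∀ x v, v ⬝ᵥ v = 1 → ∀ M : Matrix (Fin n) (Fin q) ℝ, (X *ᵥ x) ⬝ᵥ (M *ᵥ v) ≤ 0) →
      ∃ A : Set Ω, MeasurableSet A ∧ 1 - exp (-(t ^ 2 / 2)) ≤ P.real A ∧
      ∀ ω ∈ A, ∀ x v, (X *ᵥ x) ⬝ᵥ (X *ᵥ x) ≤ 1 → v ⬝ᵥ v = 1 →
        (X *ᵥ x) ⬝ᵥ (E ω *ᵥ v) ≤ τ * (√(X.rank : ℝ) + √(q : ℝ) + t) := by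
    intro h
    refine ⟨Set.univ, MeasurableSet.univ, ?_, fun ω _ x v _ hv => (h x v hv _).trans
      (by positivity)⟩
    rw [probReal_univ]
    linarith [exp_pos (-(t ^ 2 / 2))]
  rcases Nat.eq_zero_or_pos q with hq | hq
  · subst hq
    refine htriv fun x v hv => ?_
    simp [dotProduct] at hv
  rcases Nat.eq_zero_or_pos X.rank with hX | hX
  · refine htriv fun x v _ M => ?_
    obtain ⟨φ, hφ⟩ := exists_isometric_coordinates X
    have h0 : (X *ᵥ x) ⬝ᵥ (X *ᵥ x) = 0 := by
      rw [← hφ]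
      have : IsEmpty (Fin X.rank) := by rw [hX]; infer_instance
      simp [dotProduct]
    rw [dotProduct_self_eq_zero.1 h0, zero_dotProduct]
  set W : Ω → Fin n × Fin q → ℝ := fun ω p => τ⁻¹ * E ω p.1 p.2 with hW
  have hWm : ∀ p : Fin n × Fin q, AEMeasurable (fun ω => τ⁻¹ * E ω p.1 p.2) P :=
    fun p => (hlaw p.1 p.2).aemeasurable.const_mul _
  have hWae : AEMeasurable W P := aemeasurable_pi_lambda _ hWm
  have hlawW : P.map W = stdGaussianPi (Fin n × Fin q) := by
    have h1 : iIndepFun (fun (p : Fin n × Fin q) (ω : Ω) => τ⁻¹ * E ω p.1 p.2) P :=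
      hindep.comp (fun _ x => τ⁻¹ * x) fun _ => by fun_prop
    rw [iIndepFun_iff_map_fun_eq_pi_map hWm] at h1
    rw [hW, h1]
    congr 1
    funext p
    have h2 : HasLaw (fun ω => τ⁻¹ * E ω p.1 p.2)
        (gaussianReal (τ⁻¹ * 0) (.mk (τ⁻¹ ^ 2) (sq_nonneg _) * (τ ^ 2).toNNReal)) P :=
      gaussianReal_const_mul (hlaw p.1 p.2) τ⁻¹
    rw [h2.map_eq, mul_zero]
    congr 1
    ext
    rw [NNReal.coe_mul, Real.coe_toNNReal _ (sq_nonneg τ)]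
    simp only [NNReal.coe_mk, NNReal.coe_one]
    field_simp
  set S : Set ((Fin a → ℝ) × (Fin q → ℝ)) :=
    {z | (X *ᵥ z.1) ⬝ᵥ (X *ᵥ z.1) ≤ 1 ∧ z.2 ⬝ᵥ z.2 = 1} with hS
  have hSne : S.Nonempty := by
    refine ⟨(0, Pi.single ⟨0, hq⟩ 1), ?_, ?_⟩ <;> simp
  -- The bilinear form is continuous in `(x, v)`, so a countable dense set of constraints suffices,
  -- and countably many reduce to finite families by monotone limits.
  obtain ⟨D, hDS, hDc, hSD⟩ :=
    (TopologicalSpace.IsSeparable.of_separableSpace S).exists_countable_dense_subset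
  have hDne : D.Nonempty := by
    rw [← closure_nonempty_iff]; exact hSne.mono hSD
  obtain ⟨z, hz⟩ := hDc.exists_eq_range hDne
  have hzS : ∀ k, z k ∈ S := fun k => hDS (hz ▸ Set.mem_range_self k)
  set T : Set (Fin n × Fin q → ℝ) := {w | ∃ k, √(X.rank : ℝ) + √(q : ℝ) + t ≤
        (fun p : Fin n × Fin q => (X *ᵥ (z k).1) p.1 * (z k).2 p.2) ⬝ᵥ w} with hT
  have hTm : MeasurableSet T := by
    rw [hT, Set.ofPred_exists]
    refine MeasurableSet.iUnion fun i => measurableSet_le measurable_const ?_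
    unfold dotProduct
    fun_prop
  have hTP : P (W ⁻¹' T) ≤ ENNReal.ofReal (exp (-(t ^ 2 / 2))) := by
    rw [← Measure.map_apply_of_aemeasurable hWae hTm, hlawW]
    exact measure_exists_nat_le_bilinear_le X hX hq ht z (fun k => (hzS k).1) (fun k => (hzS k).2)
  have hTn : NullMeasurableSet (W ⁻¹' T) P := hWae.nullMeasurableSet_preimage hTm
  -- The entries of `E` are only almost everywhere measurable, so the good event is replaced by a
  -- measurable subset of equal probability.
  obtain ⟨A, hAT, hA, hAe⟩ := hTn.compl.exists_measurable_subset_ae_eq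
  refine ⟨A, hA, ?_, fun ω hω x v hx hv => ?_⟩
  · rw [measureReal_congr hAe, probReal_compl_eq_one_sub₀ hTn]
    have : P.real (W ⁻¹' T) ≤ exp (-(t ^ 2 / 2)) := by
      rw [Measure.real]
      exact ENNReal.toReal_le_of_le_ofReal (exp_pos _).le hTP
    linarith
  · have hclosed : IsClosed {z : (Fin a → ℝ) × (Fin q → ℝ) |
        (X *ᵥ z.1) ⬝ᵥ (E ω *ᵥ z.2) ≤ τ * (√(X.rank : ℝ) + √(q : ℝ) + t)} := by
      refine isClosed_le ?_ continuous_const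
      unfold dotProduct Matrix.mulVec dotProduct
      fun_prop
    have hD : D ⊆ {z : (Fin a → ℝ) × (Fin q → ℝ) |
        (X *ᵥ z.1) ⬝ᵥ (E ω *ᵥ z.2) ≤ τ * (√(X.rank : ℝ) + √(q : ℝ) + t)} := by
      rw [hz]
      rintro _ ⟨k, rfl⟩
      have h1 : W ω ∉ T := hAT hω
      have h2 : (fun p : Fin n × Fin q => (X *ᵥ (z k).1) p.1 * (z k).2 p.2) ⬝ᵥ W ω <
          √(X.rank : ℝ) + √(q : ℝ) + t := by
        by_contra hcon
        exact h1 ⟨k, not_lt.1 hcon⟩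
      have h3 : (fun p : Fin n × Fin q => (X *ᵥ (z k).1) p.1 * (z k).2 p.2) ⬝ᵥ W ω =
          τ⁻¹ * ((X *ᵥ (z k).1) ⬝ᵥ (E ω *ᵥ (z k).2)) := by
        rw [dotProduct, dotProduct, ← Finset.univ_product_univ, Finset.sum_product,
          Finset.mul_sum]
        refine Finset.sum_congr rfl fun i _ => ?_
        have e : (E ω *ᵥ (z k).2) i = ∑ j, E ω i j * (z k).2 j := rfl
        rw [e, Finset.mul_sum, Finset.mul_sum]
        exact Finset.sum_congr rfl fun j _ => by simp only [hW]; ring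
      rw [h3, inv_mul_lt_iff₀ hτ] at h2
      exact h2.le
    exact hclosed.closure_subset_iff.2 hD (hSD (show (x, v) ∈ S from ⟨hx, hv⟩))

end GaussianEvent

/-! ### Contractions, the unit ball dual to the nuclear norm. -/

section Contraction

variable {a b c : Type*} [Fintype a] [Fintype b] [Fintype c]

theorem mulVec_dotProduct_mulVec (A : Matrix c a ℝ) (B : Matrix c b ℝ) (x : a → ℝ) (y : b → ℝ) :
    (A *ᵥ x) ⬝ᵥ (B *ᵥ y) = x ⬝ᵥ ((Aᵀ * B) *ᵥ y) := by
  rw [← mulVec_mulVec, dotProduct_mulVec x, vecMul_transpose]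

/-- A matrix whose operator norm is at most one. -/
def IsContraction (Q : Matrix a b ℝ) : Prop := ∀ y, (Q *ᵥ y) ⬝ᵥ (Q *ᵥ y) ≤ y ⬝ᵥ y

theorem IsContraction.mul {Q : Matrix a b ℝ} {R : Matrix b c ℝ} (hQ : IsContraction Q)
    (hR : IsContraction R) : IsContraction (Q * R) := fun y => by
  rw [← mulVec_mulVec]
  exact (hQ _).trans (hR y)

/-- `|Qᵀx|² = x · QQᵀx ≤ (|x|² + |QQᵀx|²) / 2 ≤ (|x|² + |Qᵀx|²) / 2`. -/
theorem IsContraction.transpose {Q : Matrix a b ℝ} (hQ : IsContraction Q) :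
    IsContraction Qᵀ := fun x => by
  have h1 : (Qᵀ *ᵥ x) ⬝ᵥ (Qᵀ *ᵥ x) = x ⬝ᵥ (Q *ᵥ (Qᵀ *ᵥ x)) := by
    rw [mulVec_dotProduct_mulVec, transpose_transpose, mulVec_mulVec]
  have h2 := two_mul_dotProduct_le x (Q *ᵥ (Qᵀ *ᵥ x))
  have h3 := hQ (Qᵀ *ᵥ x)
  linarith

theorem isContraction_of_transpose_mul_self [DecidableEq b] {U : Matrix a b ℝ}
    (hU : Uᵀ * U = 1) : IsContraction U := fun y => by
  rw [mulVec_dotProduct_mulVec, hU, one_mulVec]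

theorem IsContraction.dotProduct_mulVec_le {Q : Matrix a b ℝ} (hQ : IsContraction Q)
    {u : a → ℝ} {v : b → ℝ} (hu : u ⬝ᵥ u ≤ 1) (hv : v ⬝ᵥ v ≤ 1) : u ⬝ᵥ (Q *ᵥ v) ≤ 1 := by
  have h1 := two_mul_dotProduct_le u (Q *ᵥ v)
  have h2 := hQ v
  linarith

theorem IsContraction.neg_dotProduct_mulVec_le {Q : Matrix a b ℝ} (hQ : IsContraction Q)
    {u : a → ℝ} {v : b → ℝ} (hu : u ⬝ᵥ u ≤ 1) (hv : v ⬝ᵥ v ≤ 1) : u ⬝ᵥ (-Q *ᵥ v) ≤ 1 := by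
  have h := hQ.dotProduct_mulVec_le (u := -u) (by simpa using hu) hv
  simpa [neg_mulVec] using h

theorem IsContraction.sum_sq_col_le [DecidableEq b] {Q : Matrix a b ℝ} (hQ : IsContraction Q)
    (j : b) : ∑ i, Q i j ^ 2 ≤ 1 := by
  have h := hQ (Pi.single j 1)
  simpa [dotProduct, pow_two, Pi.single_apply] using h

theorem IsContraction.sum_sq_row_le [DecidableEq a] {Q : Matrix a b ℝ} (hQ : IsContraction Q)
    (i : a) : ∑ j, Q i j ^ 2 ≤ 1 := hQ.transpose.sum_sq_col_le i

theorem IsContraction.neg_one_le_apply [DecidableEq b] {Q : Matrix a b ℝ} (hQ : IsContraction Q)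
    (i : a) (j : b) : -1 ≤ Q i j := by
  have h : Q i j ^ 2 ≤ 1 := (Finset.single_le_sum (f := fun i => Q i j ^ 2)
    (fun _ _ => sq_nonneg _) (Finset.mem_univ i)).trans (hQ.sum_sq_col_le j)
  nlinarith

end Contraction

/-! ### Singular value decomposition and nuclear norm duality. -/

section SingularValueDecomposition

variable {a b : ℕ}

theorem sigma_nonneg (D : Matrix (Fin a) (Fin b) ℝ) (l : ℕ) : 0 ≤ sigma D l :=
  LinearMap.singularValues_nonneg _ _

theorem sigma_le_sigma_one (D : Matrix (Fin a) (Fin b) ℝ) (l : ℕ) : sigma D l ≤ sigma D 1 :=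
  (Matrix.toEuclideanLin D).singularValues_antitone (by simp)

/-- A singular value decomposition `D = G diag(σ) Vᵀ` with `V` orthogonal, where the columns of `G`
are orthogonal and have norm one or zero. -/
theorem exists_svd (D : Matrix (Fin a) (Fin b) ℝ) :
    ∃ (G : Matrix (Fin a) (Fin b) ℝ) (V : Matrix (Fin b) (Fin b) ℝ), Vᵀ * V = 1 ∧
      D = G * diagonal (fun j : Fin b => sigma D (j + 1)) * Vᵀ ∧
      Gᵀ * G = diagonal (fun j : Fin b => if sigma D (j + 1) = 0 then 0 else 1) := by
  set T := Matrix.toEuclideanLin D with hT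
  have hn : Module.finrank ℝ (EuclideanSpace ℝ (Fin b)) = b := by simp
  set e := T.isSymmetric_adjoint_comp_self.eigenvectorBasis hn with he
  set σ : Fin b → ℝ := fun j => sigma D (j + 1) with hσ
  have hσ2 : ∀ j, T.isSymmetric_adjoint_comp_self.eigenvalues hn j = σ j ^ 2 := by
    intro j
    rw [← T.sq_singularValues_fin hn]
    rfl
  set V : Matrix (Fin b) (Fin b) ℝ := Matrix.of fun i j => (e j) i with hV
  have hVV : Vᵀ * V = 1 := by
    ext i j
    have h := orthonormal_iff_ite.1 e.orthonormal j i
    rw [EuclideanSpace.inner_eq_star_dotProduct] at h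
    rw [Matrix.mul_apply, Matrix.one_apply]
    simp only [eq_comm (a := j)] at h
    rw [← h]
    rfl
  have hDV : (D * V)ᵀ * (D * V) = diagonal fun j => σ j ^ 2 := by
    ext i j
    have h1 : inner ℝ (T (e j)) (T (e i)) = σ j ^ 2 * inner ℝ (e j) (e i) := by
      rw [← LinearMap.adjoint_inner_left, ← LinearMap.comp_apply,
        LinearMap.IsSymmetric.apply_eigenvectorBasis, hσ2, inner_smul_left, ← he]
      simp
    rw [orthonormal_iff_ite.1 e.orthonormal j i, EuclideanSpace.inner_eq_star_dotProduct] at h1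
    rw [Matrix.mul_apply, diagonal_apply]
    have h2 : ∀ j, (T (e j)).ofLp = fun i => (D * V) i j := fun j => rfl
    rw [h2, h2] at h1
    simp only [eq_comm (a := i)]
    simp only [mul_ite, mul_one, mul_zero] at h1
    rw [dotProduct] at h1
    simp only [Matrix.transpose_apply, star_trivial, Pi.star_apply] at h1 ⊢
    rw [h1]
    split_ifs with h
    · rw [h]
    · rfl
  have hVV' : V * Vᵀ = 1 := mul_eq_one_comm.1 hVV
  -- The convention `0⁻¹ = 0` makes the columns belonging to zero singular values vanish.
  refine ⟨D * V * diagonal fun j => (σ j)⁻¹, V, hVV, ?_, ?_⟩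
  · have h3 : D * V * diagonal (fun j => (σ j)⁻¹) * diagonal σ = D * V := by
      ext i j
      rw [Matrix.mul_assoc, diagonal_mul_diagonal, mul_diagonal]
      by_cases h : σ j = 0
      · have h4 : ((D * V)ᵀ * (D * V)) j j = 0 := by rw [hDV, diagonal_apply_eq, h]; simp
        rw [Matrix.mul_apply] at h4
        have h5 := (Finset.sum_eq_zero_iff_of_nonneg
          (fun i _ => mul_self_nonneg ((D * V) i j))).1 h4 i (Finset.mem_univ i)
        rw [mul_self_eq_zero.1 h5, zero_mul]
      · rw [inv_mul_cancel₀ h, mul_one]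
    rw [h3, Matrix.mul_assoc, hVV', Matrix.mul_one]
  · rw [transpose_mul, diagonal_transpose, Matrix.mul_assoc, ← Matrix.mul_assoc _ (D * V), hDV,
      diagonal_mul_diagonal, diagonal_mul_diagonal]
    congr 1
    funext j
    change (σ j)⁻¹ * (σ j ^ 2 * (σ j)⁻¹) = if σ j = 0 then 0 else 1
    split_ifs with h
    · simp [h]
    · field_simp

theorem sigma_succ_eq_zero (D : Matrix (Fin a) (Fin b) ℝ) {i : ℕ} (hi : min a b ≤ i) :
    sigma D (i + 1) = 0 := by
  rw [sigma, Nat.add_sub_cancel]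
  rcases min_le_iff.1 hi with h | h
  · rw [LinearMap.singularValues_eq_zero_iff_le_finrank_range]
    exact (Submodule.finrank_le _).trans (by simpa using h)
  · exact LinearMap.singularValues_of_finrank_le _ (by simpa using h)

/-- Passes from the range `r < j ≤ min a b` to the `b` columns used by `exists_svd`; the added
singular values are zero. -/
theorem sum_Icc_sigma_eq (D : Matrix (Fin a) (Fin b) ℝ) (r : ℕ) :
    ∑ j ∈ Finset.Icc (r + 1) (min a b), sigma D j =
      ∑ j : Fin b, if r ≤ (j : ℕ) then sigma D (j + 1) else 0 := by
  rw [Fin.sum_univ_eq_sum_range (fun j => if r ≤ j then sigma D (j + 1) else 0) b,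
    ← Finset.sum_filter]
  symm
  refine Finset.sum_bij_ne_zero (fun j _ _ => j + 1) ?_ ?_ ?_ ?_
  · intro j hj h0
    rw [Finset.mem_filter] at hj
    have : j < min a b := by
      by_contra hcon
      exact h0 (sigma_succ_eq_zero D (not_lt.1 hcon))
    rw [Finset.mem_Icc]; omega
  · intro i _ _ j _ _ h; omega
  · intro j hj _
    rw [Finset.mem_Icc] at hj
    refine ⟨j - 1, ?_, ?_, by omega⟩
    · rw [Finset.mem_filter, Finset.mem_range]; omega
    · rwa [Nat.sub_add_cancel (by omega)]
  · intro j _ _; rfl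

theorem nuclearNorm_eq_sum (D : Matrix (Fin a) (Fin b) ℝ) :
    nuclearNorm D = ∑ j : Fin b, sigma D (j + 1) := by
  have h := sum_Icc_sigma_eq D 0
  simpa [nuclearNorm] using h

theorem nuclearNorm_nonneg (D : Matrix (Fin a) (Fin b) ℝ) : 0 ≤ nuclearNorm D :=
  Finset.sum_nonneg fun _ _ => sigma_nonneg _ _

theorem tailSum_nonneg (D : Matrix (Fin a) (Fin b) ℝ) (r : ℕ) : 0 ≤ tailSum D r :=
  Finset.sum_nonneg fun _ _ => sigma_nonneg _ _

theorem isContraction_of_transpose_mul_self_eq_diagonal {G : Matrix (Fin a) (Fin b) ℝ}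
    {σ : Fin b → ℝ} (hG : Gᵀ * G = diagonal fun j => if σ j = 0 then 0 else 1) :
    IsContraction G := fun y => by
  rw [mulVec_dotProduct_mulVec, hG]
  refine Finset.sum_le_sum fun j _ => ?_
  rw [mulVec_diagonal]
  split_ifs
  · rw [zero_mul, mul_zero]; exact mul_self_nonneg _
  · rw [one_mul]

/-- **Duality** between the nuclear norm and the operator norm: the norming functional. -/
theorem exists_isContraction_trace_eq (D : Matrix (Fin a) (Fin b) ℝ) :
    ∃ Q : Matrix (Fin a) (Fin b) ℝ, IsContraction Q ∧ (Qᵀ * D).trace = nuclearNorm D := by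
  obtain ⟨G, V, hV, hD, hG⟩ := exists_svd D
  refine ⟨G * Vᵀ, (isContraction_of_transpose_mul_self_eq_diagonal hG).mul
    (isContraction_of_transpose_mul_self hV).transpose, ?_⟩
  have h : (G * Vᵀ)ᵀ * D = V * (Gᵀ * G * diagonal (fun j : Fin b => sigma D (j + 1))) * Vᵀ := by
    conv_lhs => rw [hD]
    simp only [transpose_mul, transpose_transpose, Matrix.mul_assoc]
  rw [h, trace_mul_comm, ← Matrix.mul_assoc, hV, Matrix.one_mul, hG, diagonal_mul_diagonal,
    trace_diagonal, nuclearNorm_eq_sum]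
  refine Finset.sum_congr rfl fun j _ => ?_
  split_ifs with h0
  · rw [h0, zero_mul]
  · rw [one_mul]

/-- **Duality** between the nuclear norm and the operator norm: the inequality. -/
theorem trace_transpose_mul_le {Q : Matrix (Fin a) (Fin b) ℝ} {c : ℝ}
    (hQ : ∀ u v, u ⬝ᵥ u ≤ 1 → v ⬝ᵥ v = 1 → u ⬝ᵥ (Q *ᵥ v) ≤ c) (D : Matrix (Fin a) (Fin b) ℝ) :
    (Qᵀ * D).trace ≤ c * nuclearNorm D := by
  obtain ⟨G, V, hV, hD, hG⟩ := exists_svd D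
  have h : (Qᵀ * D).trace = ((Gᵀ * (Q * V))ᵀ * diagonal (fun j : Fin b => sigma D (j + 1))).trace := by
    conv_lhs => rw [hD]
    rw [← Matrix.mul_assoc, trace_mul_comm]
    simp only [transpose_mul, transpose_transpose, Matrix.mul_assoc]
  rw [h, nuclearNorm_eq_sum, Finset.mul_sum, trace]
  refine Finset.sum_le_sum fun j _ => ?_
  rw [diag_apply, mul_diagonal, transpose_apply]
  refine mul_le_mul_of_nonneg_right ?_ (sigma_nonneg _ _)
  -- Columns of `G` may vanish while those of `V` are unit vectors, which is why `hQ` has a ball on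
  -- the left and a sphere on the right, as in the noise event.
  refine hQ (fun i => G i j) (fun i => V i j) ?_ ?_
  · have h1 : (Gᵀ * G) j j ≤ 1 := by
      rw [hG, diagonal_apply_eq]; split_ifs <;> norm_num
    exact h1
  · have h1 : (Vᵀ * V) j j = 1 := by rw [hV, one_apply_eq]
    exact h1

theorem mulVec_dotProduct_self_le (D : Matrix (Fin a) (Fin b) ℝ) (x : Fin b → ℝ) :
    (D *ᵥ x) ⬝ᵥ (D *ᵥ x) ≤ sigma D 1 ^ 2 * (x ⬝ᵥ x) := by
  obtain ⟨G, V, hV, hD, hG⟩ := exists_svd D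
  conv_lhs => rw [hD]
  rw [← mulVec_mulVec, ← mulVec_mulVec]
  refine (isContraction_of_transpose_mul_self_eq_diagonal hG _).trans ?_
  refine le_trans ?_ (mul_le_mul_of_nonneg_left
    ((isContraction_of_transpose_mul_self hV).transpose x) (sq_nonneg _))
  rw [dotProduct, dotProduct, Finset.mul_sum]
  refine Finset.sum_le_sum fun j _ => ?_
  rw [mulVec_diagonal]
  have h1 : sigma D (j + 1) ^ 2 ≤ sigma D 1 ^ 2 :=
    pow_le_pow_left₀ (sigma_nonneg _ _) (sigma_le_sigma_one _ _) 2
  have h2 := mul_le_mul_of_nonneg_right h1 (mul_self_nonneg ((Vᵀ *ᵥ x) j))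
  linarith

/-- The squared top singular value is an eigenvalue of `XᵀX`, so after division by `n` it is at most
the largest eigenvalue of the Gram matrix. -/
theorem sq_sigma_one_le_eigLambda {n a : ℕ} (hn : 0 < n) (ha : 0 < a)
    (X : Matrix (Fin n) (Fin a) ℝ) :
    sigma X 1 ^ 2 ≤ n * eigLambda (gram X) (gram_isHermitian X) 1 := by
  have hn0 : (n : ℝ) ≠ 0 := by positivity
  obtain ⟨v, hv⟩ := ((Matrix.toEuclideanLin X).hasEigenvalue_adjoint_comp_self_sq_singularValues
    (n := 0) (by simpa using ha)).exists_hasEigenvector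
  have hXv : Matrix.toEuclideanLin (Xᵀ * X) v = sigma X 1 ^ 2 • v := by
    refine Eq.trans ?_ hv.apply_eq_smul
    rw [LinearMap.comp_apply, ← Matrix.toEuclideanLin_conjTranspose_eq_adjoint]
    ext i
    simp [conjTranspose_eq_transpose_of_trivial, Matrix.toLpLin_apply]
  have hgv : Matrix.toEuclideanLin (gram X) v = (sigma X 1 ^ 2 / n) • v := by
    rw [gram, map_smul, LinearMap.smul_apply, hXv, smul_smul]
    congr 1
    ring
  have hev : Module.End.HasEigenvalue (Matrix.toEuclideanLin (gram X)) (sigma X 1 ^ 2 / n) :=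
    Module.End.hasEigenvalue_of_hasEigenvector
      ⟨Module.End.mem_eigenspace_iff.2 hgv, hv.2⟩
  have hmem := hev.mem_spectrum
  rw [Matrix.toEuclideanLin, Matrix.spectrum_toLpLin,
    (gram_isHermitian X).spectrum_real_eq_range_eigenvalues] at hmem
  obtain ⟨i, hi⟩ := hmem
  have h0 : 1 - 1 < Fintype.card (Fin a) := by simpa using ha
  rw [eigLambda, dif_pos h0]
  have hle : (gram_isHermitian X).eigenvalues i ≤
      (gram_isHermitian X).eigenvalues₀ ⟨1 - 1, h0⟩ :=
    (gram_isHermitian X).eigenvalues₀_antitone (Fin.mk_le_of_le_val (by simp))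
  rw [hi, div_le_iff₀ (by positivity)] at hle
  linarith

end SingularValueDecomposition

/-! ### Projections and the decomposition of the nuclear norm. -/

section Frobenius

variable {a b : ℕ}

theorem trace_transpose_mul_eq_sum (A B : Matrix (Fin a) (Fin b) ℝ) :
    (Aᵀ * B).trace = ∑ i, ∑ j, A i j * B i j := by
  rw [Finset.sum_comm]
  simp [Matrix.trace, Matrix.mul_apply]

theorem frobenius_norm_sq_eq_sum {m n : Type*} [Fintype m] [Fintype n] (A : Matrix m n ℝ) :
    ‖A‖ ^ 2 = ∑ i, ∑ j, A i j ^ 2 := by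
  have h0 : 0 ≤ ∑ i, ∑ j, ‖A i j‖ ^ (2 : ℝ) := by positivity
  rw [Matrix.frobenius_norm_def, ← Real.sqrt_eq_rpow, Real.sq_sqrt h0]
  simp

theorem trace_transpose_mul_le_norm (A B : Matrix (Fin a) (Fin b) ℝ) :
    (Aᵀ * B).trace ≤ ‖A‖ * ‖B‖ :=
  real_inner_le_norm A B

theorem trace_transpose_mul_self (A : Matrix (Fin a) (Fin b) ℝ) : (Aᵀ * A).trace = ‖A‖ ^ 2 :=
  real_inner_self_eq_norm_sq A

/-- The Frobenius inner product is invariant under orthogonal changes of coordinates. -/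
theorem trace_transpose_mul_rotate {U : Matrix (Fin a) (Fin a) ℝ} {V : Matrix (Fin b) (Fin b) ℝ}
    (hU : Uᵀ * U = 1) (hV : Vᵀ * V = 1) (A B : Matrix (Fin a) (Fin b) ℝ) :
    ((Uᵀ * A * V)ᵀ * (Uᵀ * B * V)).trace = (Aᵀ * B).trace := by
  have hU' : U * Uᵀ = 1 := mul_eq_one_comm.1 hU
  have hV' : V * Vᵀ = 1 := mul_eq_one_comm.1 hV
  have h : (Uᵀ * A * V)ᵀ * (Uᵀ * B * V) = Vᵀ * (Aᵀ * (U * Uᵀ) * B * V) := by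
    simp only [transpose_mul, transpose_transpose, Matrix.mul_assoc]
  rw [h, trace_mul_comm, hU', Matrix.mul_one, Matrix.mul_assoc, hV', Matrix.mul_one]

/-- In the coordinates `Uᵀ * D * V` the subspace consists of the matrices supported on the trailing
block. -/
theorem mem_subspaceB_iff {U : Matrix (Fin a) (Fin a) ℝ} {V : Matrix (Fin b) (Fin b) ℝ}
    (hU : Uᵀ * U = 1) (hV : Vᵀ * V = 1) {r : ℕ} {D : Matrix (Fin a) (Fin b) ℝ} :
    D ∈ subspaceB U V r ↔
      ∀ (i : Fin a) (j : Fin b), (i : ℕ) < r ∨ (j : ℕ) < r → (Uᵀ * D * V) i j = 0 := by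
  have hU' : U * Uᵀ = 1 := mul_eq_one_comm.1 hU
  have hV' : V * Vᵀ = 1 := mul_eq_one_comm.1 hV
  have e1 : ∀ i j, D.row i ⬝ᵥ V.col j = (D * V) i j := fun i j => rfl
  have e2 : ∀ i j, D.col j ⬝ᵥ U.col i = (Uᵀ * D) i j := fun i j => dotProduct_comm _ _
  have hmem : D ∈ subspaceB U V r ↔ (∀ i, ∀ j : Fin b, (j : ℕ) < r → (D * V) i j = 0) ∧
      ∀ j, ∀ i : Fin a, (i : ℕ) < r → (Uᵀ * D) i j = 0 := by
    simp only [← e1, ← e2]; rfl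
  rw [hmem]
  constructor
  · rintro ⟨h1, h2⟩ i j (hi | hj)
    · rw [Matrix.mul_apply]
      exact Finset.sum_eq_zero fun k _ => by rw [h2 k i hi, zero_mul]
    · rw [Matrix.mul_assoc, Matrix.mul_apply]
      exact Finset.sum_eq_zero fun k _ => by rw [h1 k j hj, mul_zero]
  · intro h
    constructor
    · intro i j hj
      have : D * V = U * (Uᵀ * D * V) := by
        rw [Matrix.mul_assoc Uᵀ, ← Matrix.mul_assoc U, hU', Matrix.one_mul]
      rw [this, Matrix.mul_apply]
      exact Finset.sum_eq_zero fun k _ => by rw [h k j (Or.inr hj), mul_zero]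
    · intro j i hi
      have : Uᵀ * D = Uᵀ * D * V * Vᵀ := by rw [Matrix.mul_assoc, hV', Matrix.mul_one]
      rw [this, Matrix.mul_apply]
      exact Finset.sum_eq_zero fun k _ => by rw [h i k (Or.inl hi), zero_mul]

theorem projB_mem (U : Matrix (Fin a) (Fin a) ℝ) (V : Matrix (Fin b) (Fin b) ℝ) (r : ℕ)
    (D : Matrix (Fin a) (Fin b) ℝ) : projB U V r D ∈ subspaceB U V r :=
  Submodule.starProjection_apply_mem _ _

theorem trace_transpose_mul_sub_projB {U : Matrix (Fin a) (Fin a) ℝ}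
    {V : Matrix (Fin b) (Fin b) ℝ} {r : ℕ} (D : Matrix (Fin a) (Fin b) ℝ)
    {M : Matrix (Fin a) (Fin b) ℝ} (hM : M ∈ subspaceB U V r) :
    (Mᵀ * (D - projB U V r D)).trace = 0 :=
  (Submodule.mem_orthogonal _ _).1
    (Submodule.sub_starProjection_mem_orthogonal (K := subspaceB U V r) D) M hM

theorem norm_sub_projB_le (U : Matrix (Fin a) (Fin a) ℝ)
    (V : Matrix (Fin b) (Fin b) ℝ) (r : ℕ) (D : Matrix (Fin a) (Fin b) ℝ) :
    ‖D - projB U V r D‖ ≤ ‖D‖ := by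
  have h := trace_transpose_mul_sub_projB D (projB_mem U V r D)
  set N := projB U V r D
  have h1 : D = N + (D - N) := by abel
  have h2 : ‖N + (D - N)‖ ^ 2 = ‖N‖ ^ 2 + 2 * (Nᵀ * (D - N)).trace + ‖D - N‖ ^ 2 :=
    norm_add_sq_real N (D - N)
  rw [← h1, h] at h2
  exact le_of_sq_le_sq (by nlinarith [sq_nonneg ‖N‖]) (norm_nonneg _)

theorem sum_fin_ite_lt_le (n r : ℕ) : ∑ i : Fin n, (if (i : ℕ) < r then (1 : ℝ) else 0) ≤ r := by
  rw [Fin.sum_univ_eq_sum_range (fun i => if i < r then (1 : ℝ) else 0) n, Finset.sum_boole]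
  have h : (Finset.range n).filter (· < r) ⊆ Finset.range r := fun i hi => by
    simpa using (Finset.mem_filter.1 hi).2
  exact_mod_cast (Finset.card_le_card h).trans (by simp)

/-- The component of a matrix orthogonal to `subspaceB U V r` satisfies the comparison of nuclear
and Frobenius norms of a matrix of rank at most `2 r`. -/
theorem nuclearNorm_sub_projB_le {U : Matrix (Fin a) (Fin a) ℝ} {V : Matrix (Fin b) (Fin b) ℝ}
    (hU : Uᵀ * U = 1) (hV : Vᵀ * V = 1) (r : ℕ) (D : Matrix (Fin a) (Fin b) ℝ) :
    nuclearNorm (D - projB U V r D) ≤ √(2 * r) * ‖D‖ := by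
  obtain ⟨Q, hQ, hQD⟩ := exists_isContraction_trace_eq (D - projB U V r D)
  set W : Matrix (Fin a) (Fin b) ℝ := Uᵀ * Q * V with hW
  have hWc : IsContraction W := ((isContraction_of_transpose_mul_self hU).transpose.mul hQ).mul
    (isContraction_of_transpose_mul_self hV)
  -- The norming functional may be changed by an element of the subspace. Removing its trailing
  -- block leaves `r` rows and `r` columns of a contraction, each of norm at most one, whence `2 *
  -- r`.
  set R : Matrix (Fin a) (Fin b) ℝ :=
    Matrix.of fun i j => if (i : ℕ) < r ∨ (j : ℕ) < r then 0 else W i j with hR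
  have hrot : Uᵀ * (U * R * Vᵀ) * V = R := by
    rw [Matrix.mul_assoc U, ← Matrix.mul_assoc Uᵀ, hU, Matrix.one_mul, Matrix.mul_assoc, hV,
      Matrix.mul_one]
  have hM : U * R * Vᵀ ∈ subspaceB U V r := by
    rw [mem_subspaceB_iff hU hV, hrot]
    intro i j hij
    simp [hR, hij]
  have h1 : (Qᵀ * (D - projB U V r D)).trace =
      ((Q - U * R * Vᵀ)ᵀ * (D - projB U V r D)).trace := by
    rw [transpose_sub, Matrix.sub_mul, trace_sub, trace_transpose_mul_sub_projB D hM, sub_zero]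
  have h2 : ‖Q - U * R * Vᵀ‖ ^ 2 ≤ 2 * r := by
    rw [← trace_transpose_mul_self, ← trace_transpose_mul_rotate hU hV, Matrix.mul_sub,
      Matrix.sub_mul, hrot, trace_transpose_mul_self, frobenius_norm_sq_eq_sum]
    calc ∑ i, ∑ j, (W - R) i j ^ 2 ≤ ∑ i : Fin a, ∑ j : Fin b,
          ((if (i : ℕ) < r then 1 else 0) * W i j ^ 2 +
            (if (j : ℕ) < r then 1 else 0) * W i j ^ 2) := by
          refine Finset.sum_le_sum fun i _ => Finset.sum_le_sum fun j _ => ?_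
          have h3 := sq_nonneg (W i j)
          simp only [hR, Matrix.sub_apply, Matrix.of_apply]
          by_cases hi : (i : ℕ) < r <;> by_cases hj : (j : ℕ) < r <;> simp [hi, hj, h3]
      _ = ∑ i : Fin a, (if (i : ℕ) < r then 1 else 0) * ∑ j, W i j ^ 2 +
          ∑ j : Fin b, (if (j : ℕ) < r then 1 else 0) * ∑ i, W i j ^ 2 := by
          simp only [Finset.sum_add_distrib, Finset.mul_sum]
          congr 1
          exact Finset.sum_comm
      _ ≤ ∑ i : Fin a, (if (i : ℕ) < r then (1 : ℝ) else 0) +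
          ∑ j : Fin b, (if (j : ℕ) < r then (1 : ℝ) else 0) := by
          refine add_le_add (Finset.sum_le_sum fun i _ => ?_) (Finset.sum_le_sum fun j _ => ?_)
          · exact mul_le_of_le_one_right (by positivity) (hWc.sum_sq_row_le i)
          · exact mul_le_of_le_one_right (by positivity) (hWc.sum_sq_col_le j)
      _ ≤ r + r := add_le_add (sum_fin_ite_lt_le a r) (sum_fin_ite_lt_le b r)
      _ = _ := by ring
  rw [← hQD, h1]
  refine (trace_transpose_mul_le_norm _ _).trans ?_
  exact mul_le_mul (Real.le_sqrt_of_sq_le h2) (norm_sub_projB_le U V r D) (norm_nonneg _)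
    (sqrt_nonneg _)

/-- Completing a contraction by the identity on the leading `r` coordinates. -/
theorem exists_isContraction_complete {r : ℕ} (hra : r ≤ a) {W : Matrix (Fin a) (Fin b) ℝ}
    (hW : IsContraction W) :
    ∃ Z : Matrix (Fin a) (Fin b) ℝ, IsContraction Z ∧
      (∀ (i : Fin a) (j : Fin b), (i : ℕ) = j → (j : ℕ) < r → Z i j = 1) ∧
      ∀ (i : Fin a) (j : Fin b), r ≤ (i : ℕ) → r ≤ (j : ℕ) → Z i j = W i j := by
  set J : Matrix (Fin a) (Fin b) ℝ :=
    Matrix.of fun i j => if (i : ℕ) = j ∧ (j : ℕ) < r then 1 else 0 with hJ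
  set M : (n : ℕ) → Fin n → ℝ := fun n i => if (i : ℕ) < r then 0 else 1 with hM
  have hJJ : Jᵀ * J = diagonal fun j : Fin b => if (j : ℕ) < r then 1 else 0 := by
    ext j l
    rw [Matrix.mul_apply, diagonal_apply]
    simp only [transpose_apply, hJ, Matrix.of_apply]
    by_cases hj : (j : ℕ) < r
    · rw [Finset.sum_eq_single (⟨j, by omega⟩ : Fin a)]
      · by_cases hjl : j = l
        · subst hjl; simp [hj]
        · have : (j : ℕ) ≠ l := fun h => hjl (Fin.ext h)
          simp [hj, hjl, this]
      · intro i _ hi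
        have : (i : ℕ) ≠ j := fun h => hi (Fin.ext h)
        simp [this]
      · simp
    · simp [hj]
  have hJM : Jᵀ * diagonal (M a) = 0 := by
    ext j i
    rw [mul_diagonal, transpose_apply]
    simp only [hJ, hM, Matrix.of_apply, Matrix.zero_apply]
    split_ifs with h1 h2 <;> first | omega | simp
  refine ⟨J + diagonal (M a) * (W * diagonal (M b)), fun y => ?_, fun i j hij hj => ?_,
    fun i j hi hj => ?_⟩
  · have hcross : (J *ᵥ y) ⬝ᵥ ((diagonal (M a) * (W * diagonal (M b))) *ᵥ y) = 0 := by
      rw [mulVec_dotProduct_mulVec, ← Matrix.mul_assoc, hJM, Matrix.zero_mul, zero_mulVec,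
        dotProduct_zero]
    have hsq : ((diagonal (M a) * (W * diagonal (M b))) *ᵥ y) ⬝ᵥ
        ((diagonal (M a) * (W * diagonal (M b))) *ᵥ y) ≤
        (diagonal (M b) *ᵥ y) ⬝ᵥ (diagonal (M b) *ᵥ y) := by
      rw [← mulVec_mulVec, ← mulVec_mulVec]
      refine le_trans (Finset.sum_le_sum fun i _ => ?_) (hW _)
      rw [mulVec_diagonal]
      simp only [hM]
      split_ifs
      · rw [zero_mul, mul_zero]; exact mul_self_nonneg _
      · rw [one_mul]
    have hJy : (J *ᵥ y) ⬝ᵥ (J *ᵥ y) + (diagonal (M b) *ᵥ y) ⬝ᵥ (diagonal (M b) *ᵥ y) = y ⬝ᵥ y := by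
      rw [mulVec_dotProduct_mulVec, hJJ, dotProduct, dotProduct, dotProduct,
        ← Finset.sum_add_distrib]
      refine Finset.sum_congr rfl fun j _ => ?_
      rw [mulVec_diagonal, mulVec_diagonal]
      simp only [hM]
      split_ifs <;> ring
    rw [add_mulVec, add_dotProduct, dotProduct_add, dotProduct_add, hcross,
      dotProduct_comm ((diagonal (M a) * (W * diagonal (M b))) *ᵥ y) (J *ᵥ y), hcross]
    linarith
  · rw [Matrix.add_apply, diagonal_mul]
    simp [hJ, hM, hij, hj]
  · rw [Matrix.add_apply, diagonal_mul, mul_diagonal]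
    simp [hJ, hM, not_lt.2 hi, not_lt.2 hj]

/-- The decrease of the nuclear norm under a perturbation is controlled by the tail of the
singular values and the two components of the perturbation. -/
theorem nuclearNorm_sub_nuclearNorm_add_le {B : Matrix (Fin a) (Fin b) ℝ}
    {U : Matrix (Fin a) (Fin a) ℝ} {V : Matrix (Fin b) (Fin b) ℝ} (hB : IsFullSVD B U V)
    {r : ℕ} (hr : r ≤ min a b) (D : Matrix (Fin a) (Fin b) ℝ) :
    nuclearNorm B - nuclearNorm (B + D) ≤ 2 * tailSum B r +
      nuclearNorm (D - projB U V r D) - nuclearNorm (projB U V r D) := by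
  obtain ⟨hU, hV, hBUV⟩ := hB
  set S : Matrix (Fin a) (Fin b) ℝ := Matrix.of (fun (i : Fin a) (j : Fin b) =>
      if (i : ℕ) = (j : ℕ) then sigma B ((i : ℕ) + 1) else 0) with hS
  obtain ⟨Q₀, hQ₀, hQD⟩ := exists_isContraction_trace_eq (projB U V r D)
  have hUc := isContraction_of_transpose_mul_self hU
  have hVc := isContraction_of_transpose_mul_self hV
  -- `U * Z * Vᵀ` is the dual certificate: identity on the leading directions of `B`, norming
  -- functional of the projection of `D` on the trailing block.
  obtain ⟨Z, hZ, hZ₁, hZ₀⟩ := exists_isContraction_complete (hr.trans (min_le_left a b))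
    ((hUc.transpose.mul hQ₀).mul hVc)
  have hQ : IsContraction (U * Z * Vᵀ) := (hUc.mul hZ).mul hVc.transpose
  have hrot : ∀ R : Matrix (Fin a) (Fin b) ℝ, Uᵀ * (U * R * Vᵀ) * V = R := by
    intro R
    rw [Matrix.mul_assoc U, ← Matrix.mul_assoc Uᵀ, hU, Matrix.one_mul, Matrix.mul_assoc, hV,
      Matrix.mul_one]
  have h1 : nuclearNorm B - 2 * tailSum B r ≤ ((U * Z * Vᵀ)ᵀ * B).trace := by
    have e1 : nuclearNorm B - 2 * tailSum B r = ∑ j : Fin b,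
        (sigma B (j + 1) - 2 * if r ≤ (j : ℕ) then sigma B (j + 1) else 0) := by
      rw [Finset.sum_sub_distrib, ← Finset.mul_sum, ← nuclearNorm_eq_sum, ← sum_Icc_sigma_eq]
      rfl
    have e2 : ((U * Z * Vᵀ)ᵀ * B).trace = ∑ j, ∑ i, Z i j * S i j := by
      rw [← trace_transpose_mul_rotate hU hV, hrot]
      have : Uᵀ * B * V = S := by
        conv_lhs => rw [hBUV]
        exact hrot S
      rw [this, trace_transpose_mul_eq_sum, Finset.sum_comm]
    rw [e1, e2]
    refine Finset.sum_le_sum fun j _ => ?_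
    by_cases hja : (j : ℕ) < a
    · rw [Finset.sum_eq_single (⟨j, hja⟩ : Fin a)]
      · have e3 : S ⟨j, hja⟩ j = sigma B (j + 1) := by simp [hS]
        rw [e3]
        by_cases hjr : r ≤ (j : ℕ)
        · rw [if_pos hjr]
          -- On the tail the diagonal of `Z` is only known to be at least `-1`, which costs each
          -- tail singular value twice.
          have := mul_le_mul_of_nonneg_right (hZ.neg_one_le_apply ⟨j, hja⟩ j)
            (sigma_nonneg B (j + 1))
          linarith
        · rw [if_neg hjr, hZ₁ _ _ rfl (not_le.1 hjr)]
          linarith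
      · intro i _ hi
        have : (i : ℕ) ≠ j := fun h => hi (Fin.ext h)
        simp [hS, this]
      · simp
    · have e3 : sigma B (j + 1) = 0 :=
        sigma_succ_eq_zero B ((min_le_left _ _).trans (not_lt.1 hja))
      rw [Finset.sum_eq_zero]
      · simp [e3]
      · intro i _
        have : (i : ℕ) ≠ j := by have := i.2; omega
        simp [hS, this]
  have h2 : ((U * Z * Vᵀ)ᵀ * projB U V r D).trace = nuclearNorm (projB U V r D) := by
    rw [← hQD, ← trace_transpose_mul_rotate hU hV, hrot, ← trace_transpose_mul_rotate hU hV Q₀,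
      trace_transpose_mul_eq_sum, trace_transpose_mul_eq_sum]
    refine Finset.sum_congr rfl fun i _ => Finset.sum_congr rfl fun j _ => ?_
    have hm := (mem_subspaceB_iff hU hV).1 (projB_mem U V r D) i j
    by_cases hij : (i : ℕ) < r ∨ (j : ℕ) < r
    · rw [hm hij, mul_zero, mul_zero]
    · push Not at hij
      rw [hZ₀ i j hij.1 hij.2]
  have h3 : ((-(U * Z * Vᵀ))ᵀ * (D - projB U V r D)).trace ≤
      1 * nuclearNorm (D - projB U V r D) :=
    trace_transpose_mul_le (fun u v hu hv => hQ.neg_dotProduct_mulVec_le hu hv.le) _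
  have h4 : ((U * Z * Vᵀ)ᵀ * (B + D)).trace ≤ 1 * nuclearNorm (B + D) :=
    trace_transpose_mul_le (fun u v hu hv => hQ.dotProduct_mulVec_le hu hv.le) _
  have h5 : ((U * Z * Vᵀ)ᵀ * (B + D)).trace = ((U * Z * Vᵀ)ᵀ * B).trace +
      (((U * Z * Vᵀ)ᵀ * (D - projB U V r D)).trace +
        ((U * Z * Vᵀ)ᵀ * projB U V r D).trace) := by
    rw [← trace_add, ← trace_add, ← Matrix.mul_add, ← Matrix.mul_add, sub_add_cancel]
  rw [transpose_neg, Matrix.neg_mul, trace_neg] at h3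
  linarith

end Frobenius

/-! ### The deterministic oracle inequality. -/

section OracleInequality

variable {n K q : ℕ} {p : Fin K → ℕ}

theorem mul_eq_sum_view_mul_block (X : Matrix (Fin n) (Σ k, Fin (p k)) ℝ)
    (D : Matrix (Σ k, Fin (p k)) (Fin q) ℝ) : X * D = ∑ k, view X k * block D k := by
  ext i j
  rw [Matrix.mul_apply, Fintype.sum_sigma, Matrix.sum_apply]
  rfl

theorem norm_sq_eq_sum_block (D : Matrix (Σ k, Fin (p k)) (Fin q) ℝ) :
    ‖D‖ ^ 2 = ∑ k, ‖block D k‖ ^ 2 := by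
  rw [frobenius_norm_sq_eq_sum, Fintype.sum_sigma]
  exact Finset.sum_congr rfl fun k _ => (frobenius_norm_sq_eq_sum (block D k)).symm

theorem weight_nonneg (X : Matrix (Fin n) (Σ k, Fin (p k)) ℝ) (k : Fin K) : 0 ≤ weight q X k := by
  have := sigma_nonneg (view X k) 1
  unfold weight
  positivity

theorem weight_le (hn : 0 < n) (X : Matrix (Fin n) (Σ k, Fin (p k)) ℝ) {k : Fin K}
    (hp : 0 < p k) :
    weight q X k ≤ √(eigLambda (gram (view X k)) (gram_isHermitian _) 1) *
      (√(q : ℝ) + √((view X k).rank : ℝ)) / √(n : ℝ) := by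
  have hn0 : (0 : ℝ) < n := by exact_mod_cast hn
  have h1 : sigma (view X k) 1 ≤
      √(n : ℝ) * √(eigLambda (gram (view X k)) (gram_isHermitian _) 1) := by
    rw [← sqrt_mul hn0.le]
    exact le_sqrt_of_sq_le (sq_sigma_one_le_eigLambda hn hp _)
  calc weight q X k ≤ √(n : ℝ) * √(eigLambda (gram (view X k)) (gram_isHermitian _) 1) *
        (√(q : ℝ) + √((view X k).rank : ℝ)) / n := by
        unfold weight
        gcongr
    _ = _ := by
        have h2 : √(n : ℝ) * √(n : ℝ) = n := mul_self_sqrt hn0.le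
        have h3 : 0 < √(n : ℝ) := sqrt_pos.2 hn0
        rw [div_eq_div_iff hn0.ne' h3.ne']
        linear_combination (√(eigLambda (gram (view X k)) (gram_isHermitian _) 1) *
          (√(q : ℝ) + √((view X k).rank : ℝ))) * h2

theorem weight_sq_le (hn : 0 < n) (X : Matrix (Fin n) (Σ k, Fin (p k)) ℝ) {k : Fin K}
    (hp : 0 < p k) :
    weight q X k ^ 2 ≤ eigLambda (gram (view X k)) (gram_isHermitian _) 1 *
      (√(q : ℝ) + √((view X k).rank : ℝ)) ^ 2 / n := by
  have hn0 : (0 : ℝ) < n := by exact_mod_cast hn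
  have h1 := sq_sigma_one_le_eigLambda hn hp (view X k)
  unfold weight
  rw [div_pow, mul_pow, div_le_div_iff₀ (by positivity) hn0]
  have h2 := mul_le_mul_of_nonneg_right h1
    (by positivity : 0 ≤ (√(q : ℝ) + √((view X k).rank : ℝ)) ^ 2 * n)
  linarith

/-- The operator norm of `X_kᵀ E` is controlled by that of `E` on the column space of `X_k`. -/
theorem dotProduct_transpose_view_mul_le (hn : 0 < n) {X : Matrix (Fin n) (Σ k, Fin (p k)) ℝ}
    {E : Matrix (Fin n) (Fin q) ℝ} {c : ℝ} (hc : 0 ≤ c) {k : Fin K}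
    (hE : ∀ x v, (view X k *ᵥ x) ⬝ᵥ (view X k *ᵥ x) ≤ 1 → v ⬝ᵥ v = 1 →
      (view X k *ᵥ x) ⬝ᵥ (E *ᵥ v) ≤ c * (√(q : ℝ) + √((view X k).rank : ℝ)))
    {u : Fin (p k) → ℝ} {v : Fin q → ℝ} (hu : u ⬝ᵥ u ≤ 1) (hv : v ⬝ᵥ v = 1) :
    u ⬝ᵥ (((view X k)ᵀ * E) *ᵥ v) ≤ n * (c * weight q X k) := by
  have hn0 : (0 : ℝ) < n := by exact_mod_cast hn
  rw [← mulVec_dotProduct_mulVec]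
  set σ := sigma (view X k) 1 with hσ
  have h1 : (view X k *ᵥ u) ⬝ᵥ (view X k *ᵥ u) ≤ σ ^ 2 :=
    (mulVec_dotProduct_self_le (view X k) u).trans (mul_le_of_le_one_right (sq_nonneg _) hu)
  -- If the top singular value is zero then `X_k u = 0`; otherwise `u / σ` is admissible in `hE`.
  rcases (sigma_nonneg (view X k) 1).eq_or_lt with h0 | h0
  · rw [hσ, ← h0, zero_pow two_ne_zero] at h1
    rw [dotProduct_self_eq_zero.1 (le_antisymm h1 (dotProduct_self_nonneg_real _)),
      zero_dotProduct]
    exact mul_nonneg hn0.le (mul_nonneg hc (weight_nonneg X k))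
  · have hσ0 : σ ≠ 0 := h0.ne'
    have h2 := hE (σ⁻¹ • u) v (by
      rw [mulVec_smul, smul_dotProduct, dotProduct_smul, smul_eq_mul, smul_eq_mul]
      calc _ ≤ σ⁻¹ * (σ⁻¹ * σ ^ 2) := by gcongr
        _ = 1 := by field_simp) hv
    rw [mulVec_smul, smul_dotProduct, smul_eq_mul, inv_mul_le_iff₀ h0] at h2
    refine h2.trans (le_of_eq ?_)
    rw [weight]
    field_simp

/-- The objective at `Bhat` is compared with its value at `B₀`; after expanding the square, `‖E‖²`
cancels. -/
theorem objective_basic_inequality (hn : 0 < n) {X : Matrix (Fin n) (Σ k, Fin (p k)) ℝ}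
    {B₀ Bhat : Matrix (Σ k, Fin (p k)) (Fin q) ℝ} {E : Matrix (Fin n) (Fin q) ℝ} {lam : ℝ}
    (hest : IsEstimate X (X * B₀ + E) lam Bhat) :
    1 / (2 * (n : ℝ)) * ‖X * (Bhat - B₀)‖ ^ 2 ≤
      1 / (n : ℝ) * (Eᵀ * (X * (Bhat - B₀))).trace + lam * ∑ k, weight q X k *
        (nuclearNorm (block B₀ k) - nuclearNorm (block B₀ k + block (Bhat - B₀) k)) := by
  have hn0 : (0 : ℝ) < n := by exact_mod_cast hn
  have h := isMinOn_iff.1 hest B₀ (Set.mem_univ _)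
  unfold objective at h
  have e1 : X * B₀ + E - X * Bhat = E - X * (Bhat - B₀) := by
    rw [Matrix.mul_sub]; abel
  have e2 : X * B₀ + E - X * B₀ = E := by abel
  have e3 : ‖E - X * (Bhat - B₀)‖ ^ 2 =
      ‖E‖ ^ 2 - 2 * (Eᵀ * (X * (Bhat - B₀))).trace + ‖X * (Bhat - B₀)‖ ^ 2 :=
    norm_sub_sq_real E (X * (Bhat - B₀))
  have e4 : ∀ k, block B₀ k + block (Bhat - B₀) k = block Bhat k := by
    intro k
    ext i j
    simp [block]
  rw [e1, e2, e3] at h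
  simp only [e4, mul_sub, Finset.sum_sub_distrib]
  have e5 : 1 / (n : ℝ) = 2 * (1 / (2 * (n : ℝ))) := by field_simp
  rw [e5]
  linarith

/-- On the noise event, the estimation error obeys the cone inequality with its quadratic term. -/
theorem prediction_error_le (hn : 0 < n) {X : Matrix (Fin n) (Σ k, Fin (p k)) ℝ}
    {B₀ Bhat : Matrix (Σ k, Fin (p k)) (Fin q) ℝ} {E : Matrix (Fin n) (Fin q) ℝ}
    {U : ∀ k, Matrix (Fin (p k)) (Fin (p k)) ℝ} {V : Fin K → Matrix (Fin q) (Fin q) ℝ}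
    (hSVD : ∀ k, IsFullSVD (block B₀ k) (U k) (V k)) {r : Fin K → ℕ}
    (hr : ∀ k, r k ≤ min (p k) q) {lam : ℝ} (hlam : 0 < lam)
    (hE : ∀ k x v, (view X k *ᵥ x) ⬝ᵥ (view X k *ᵥ x) ≤ 1 → v ⬝ᵥ v = 1 →
      (view X k *ᵥ x) ⬝ᵥ (E *ᵥ v) ≤ lam / 2 * (√(q : ℝ) + √((view X k).rank : ℝ)))
    (hest : IsEstimate X (X * B₀ + E) lam Bhat) :
    1 / (2 * (n : ℝ)) * ‖X * (Bhat - B₀)‖ ^ 2 ≤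
      lam / 2 * ∑ k, (3 * weight q X k * nuclearNorm (block (Bhat - B₀) k -
            projB (U k) (V k) (r k) (block (Bhat - B₀) k)) +
          4 * weight q X k * tailSum (block B₀ k) (r k) -
          weight q X k * nuclearNorm (projB (U k) (V k) (r k) (block (Bhat - B₀) k))) := by
  have hn0 : (0 : ℝ) < n := by exact_mod_cast hn
  refine (objective_basic_inequality hn hest).trans ?_
  set D := Bhat - B₀
  have h1 : (Eᵀ * (X * D)).trace = ∑ k, (((view X k)ᵀ * E)ᵀ * block D k).trace := by
    rw [mul_eq_sum_view_mul_block, Matrix.mul_sum, trace_sum]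
    simp only [transpose_mul, transpose_transpose, Matrix.mul_assoc]
  rw [h1, Finset.mul_sum, Finset.mul_sum, Finset.mul_sum, ← Finset.sum_add_distrib]
  refine Finset.sum_le_sum fun k _ => ?_
  set w := weight q X k
  set N := projB (U k) (V k) (r k) (block D k) with hN
  have hbd := fun M => trace_transpose_mul_le
    (fun u v hu hv => dotProduct_transpose_view_mul_le hn (half_pos hlam).le (hE k) hu hv) M
  have h2 : (((view X k)ᵀ * E)ᵀ * block D k).trace ≤
      n * (lam / 2 * w) * nuclearNorm (block D k - N) + n * (lam / 2 * w) * nuclearNorm N := by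
    have e : block D k = (block D k - N) + N := by abel
    conv_lhs => rw [e, Matrix.mul_add, trace_add]
    exact add_le_add (hbd _) (hbd _)
  have h3 := mul_le_mul_of_nonneg_left h2 (one_div_nonneg.2 hn0.le)
  have e4 : 1 / (n : ℝ) * (n * (lam / 2 * w) * nuclearNorm (block D k - N) +
      n * (lam / 2 * w) * nuclearNorm N) =
      lam / 2 * (w * nuclearNorm (block D k - N) + w * nuclearNorm N) := by
    field_simp
  have h5 := mul_le_mul_of_nonneg_left
    (nuclearNorm_sub_nuclearNorm_add_le (hSVD k) (hr k) (block D k))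
    (mul_nonneg hlam.le (weight_nonneg X k : 0 ≤ w))
  rw [← hN] at h5
  rw [e4] at h3
  linarith

/-- The deterministic oracle inequality on the noise event. -/
theorem norm_sq_sub_le (hn : 0 < n) {X : Matrix (Fin n) (Σ k, Fin (p k)) ℝ}
    {B₀ Bhat : Matrix (Σ k, Fin (p k)) (Fin q) ℝ} {E : Matrix (Fin n) (Fin q) ℝ}
    {U : ∀ k, Matrix (Fin (p k)) (Fin (p k)) ℝ} {V : Fin K → Matrix (Fin q) (Fin q) ℝ}
    (hSVD : ∀ k, IsFullSVD (block B₀ k) (U k) (V k)) {r : Fin K → ℕ}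
    (hr : ∀ k, r k ≤ min (p k) q) {δ κ : ℝ}
    (hRE : RestrictedEigenvalue X (restrictedSet X B₀ U V r δ) κ) {lam : ℝ} (hlam : 0 < lam)
    (hE : ∀ k x v, (view X k *ᵥ x) ⬝ᵥ (view X k *ᵥ x) ≤ 1 → v ⬝ᵥ v = 1 →
      (view X k *ᵥ x) ⬝ᵥ (E *ᵥ v) ≤ lam / 2 * (√(q : ℝ) + √((view X k).rank : ℝ)))
    (hest : IsEstimate X (X * B₀ + E) lam Bhat) :
    ‖Bhat - B₀‖ ^ 2 ≤ δ ^ 2 ∨ ‖Bhat - B₀‖ ^ 2 ≤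
      9 / 2 * lam ^ 2 / κ ^ 2 * ∑ k, weight q X k ^ 2 * r k +
        4 * lam / κ * ∑ k, weight q X k * tailSum (block B₀ k) (r k) := by
  obtain ⟨hκ, hRE⟩ := hRE
  have hpred := prediction_error_le hn hSVD hr hlam hE hest
  set D := Bhat - B₀
  rcases lt_or_ge ‖D‖ δ with hδ | hδ
  · exact Or.inl (pow_le_pow_left₀ (norm_nonneg _) hδ.le 2)
  right
  have hcone : D ∈ restrictedSet X B₀ U V r δ := by
    refine ⟨hδ, ?_⟩
    -- The prediction error is nonnegative, and this alone yields the cone inequality.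
    have h0 : 0 ≤ lam / 2 * _ := le_trans (by positivity) hpred
    have h1 := nonneg_of_mul_nonneg_right h0 (half_pos hlam)
    rw [Finset.sum_sub_distrib] at h1
    linarith
  have h1 := (hRE D hcone).trans hpred
  have h2 : lam / 2 * ∑ k, (3 * weight q X k * nuclearNorm (block D k -
            projB (U k) (V k) (r k) (block D k)) +
          4 * weight q X k * tailSum (block B₀ k) (r k) -
          weight q X k * nuclearNorm (projB (U k) (V k) (r k) (block D k))) ≤
      ∑ k, (9 / 4 * lam ^ 2 / κ * (weight q X k ^ 2 * r k) + κ / 2 * ‖block D k‖ ^ 2 +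
        2 * lam * (weight q X k * tailSum (block B₀ k) (r k))) := by
    rw [Finset.mul_sum]
    refine Finset.sum_le_sum fun k _ => ?_
    set w := weight q X k
    have hw : 0 ≤ w := weight_nonneg X k
    have h3 := mul_le_mul_of_nonneg_left
      (nuclearNorm_sub_projB_le (hSVD k).1 (hSVD k).2.1 (r k) (block D k))
      (by positivity : 0 ≤ lam / 2 * (3 * w))
    have h4 : 0 ≤ lam / 2 * (w * nuclearNorm (projB (U k) (V k) (r k) (block D k))) :=
      mul_nonneg (by positivity) (mul_nonneg hw (nuclearNorm_nonneg _))
    have h5 : √(2 * (r k : ℝ)) ^ 2 = 2 * r k := sq_sqrt (by positivity)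
    -- Young's inequality, weighted so that the terms `κ / 2 * ‖block D k‖ ^ 2` add up to half of
    -- the left side of `h1`.
    have h6 : lam / 2 * (3 * w) * (√(2 * (r k : ℝ)) * ‖block D k‖) ≤
        9 / 4 * lam ^ 2 / κ * (w ^ 2 * r k) + κ / 2 * ‖block D k‖ ^ 2 := by
      have h7 : 9 / 4 * lam ^ 2 / κ * (w ^ 2 * r k) + κ / 2 * ‖block D k‖ ^ 2 -
          lam / 2 * (3 * w) * (√(2 * (r k : ℝ)) * ‖block D k‖) =
          (3 / 2 * lam * w * √(2 * (r k : ℝ)) - κ * ‖block D k‖) ^ 2 / (2 * κ) := by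
        rw [sub_sq, mul_pow _ (√(2 * (r k : ℝ))), h5]
        field_simp
        ring
      have h8 : 0 ≤ (3 / 2 * lam * w * √(2 * (r k : ℝ)) - κ * ‖block D k‖) ^ 2 / (2 * κ) := by
        positivity
      linarith
    linarith
  rw [Finset.sum_add_distrib, Finset.sum_add_distrib, ← Finset.mul_sum, ← Finset.mul_sum,
    ← Finset.mul_sum, ← norm_sq_eq_sum_block] at h2
  have h9 : κ / 2 * ‖D‖ ^ 2 ≤ 9 / 4 * lam ^ 2 / κ * ∑ k, weight q X k ^ 2 * r k +
      2 * lam * ∑ k, weight q X k * tailSum (block B₀ k) (r k) := by linarith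
  have h10 := mul_le_mul_of_nonneg_left h9 (by positivity : 0 ≤ 2 / κ)
  have e1 : 2 / κ * (κ / 2 * ‖D‖ ^ 2) = ‖D‖ ^ 2 := by field_simp
  rw [e1] at h10
  refine h10.trans (le_of_eq ?_)
  field_simp
  ring

end OracleInequality

end IRRR

/-! ### Union bound over the views and final constants. -/

theorem theorem2 :
    ∃ C : ℝ, 0 < C ∧
      ∀ (n K q : ℕ) (p : Fin K → ℕ) (_hn : 0 < n)
        -- the design matrix `X`, the true coefficient matrix `B₀` and full SVDs of its blocks
        (X : Matrix (Fin n) (Σ k, Fin (p k)) ℝ) (B₀ : Matrix (Σ k, Fin (p k)) (Fin q) ℝ)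
        (U : ∀ k, Matrix (Fin (p k)) (Fin (p k)) ℝ) (V : Fin K → Matrix (Fin q) (Fin q) ℝ)
        (_hSVD : ∀ k, IRRR.IsFullSVD (IRRR.block B₀ k) (U k) (V k))
        -- the restricted eigenvalue condition
        (r : Fin K → ℕ) (_hr : ∀ k, 1 ≤ r k ∧ r k ≤ min (p k) q)
        (δ κ : ℝ)
        (_hRE : IRRR.RestrictedEigenvalue X (IRRR.restrictedSet X B₀ U V r δ) κ)
        -- the Gaussian errors
        (Ω : Type*) (_mΩ : MeasurableSpace Ω) (P : Measure Ω) (_hP : IsProbabilityMeasure P)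
        (τ : ℝ) (_hτ : 0 < τ)
        (E : Ω → Matrix (Fin n) (Fin q) ℝ)
        (_hlaw : ∀ i j, HasLaw (fun ω => E ω i j) (gaussianReal 0 (τ ^ 2).toNNReal) P)
        (_hindep : iIndepFun (fun (ij : Fin n × Fin q) (ω : Ω) => E ω ij.1 ij.2) P)
        (θ : ℝ) (_hθ : 0 < θ),
        ∃ A : Set Ω, MeasurableSet A ∧
          1 - ∑ k, Real.exp (-(θ ^ 2 * ((q : ℝ) + ((IRRR.view X k).rank : ℝ)) / 2)) ≤ P.real A ∧
          ∀ ω ∈ A, ∀ Bhat : Matrix (Σ k, Fin (p k)) (Fin q) ℝ,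
            IRRR.IsEstimate X (X * B₀ + E ω) (2 * (1 + θ) * τ) Bhat →
            ‖Bhat - B₀‖ ^ 2 ≤ C * max (δ ^ 2) (max
              (τ ^ 2 * (1 + θ) ^ 2 * ∑ k,
                IRRR.eigLambda (IRRR.gram (IRRR.view X k)) (IRRR.gram_isHermitian _) 1 / κ ^ 2 *
                  ((√(q : ℝ) + √((IRRR.view X k).rank : ℝ)) ^ 2 * (r k : ℝ) / n))
              (τ * (1 + θ) * ∑ k,
                √(IRRR.eigLambda (IRRR.gram (IRRR.view X k)) (IRRR.gram_isHermitian _) 1) / κ *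
                  ((√(q : ℝ) + √((IRRR.view X k).rank : ℝ)) *
                    IRRR.tailSum (IRRR.block B₀ k) (r k) / √(n : ℝ)))) := by
  -- With `λ = 2(1 + θ)τ` the coefficients `9/2 λ²` and `4 λ` become `18 τ²(1 + θ)²` and `8 τ(1 +
  -- θ)`, and `26 = 18 + 8`.
  refine ⟨26, by norm_num, ?_⟩
  intro n K q p hn X B₀ U V hSVD r hr δ κ hRE Ω _ P _ τ hτ E hlaw hindep θ hθ
  have hκ : 0 < κ := hRE.1
  have hp : ∀ k, 0 < p k := fun k => by have := hr k; omega
  -- Positivity of `q` comes from `1 ≤ r k ≤ q`, hence only in the presence of a view: `K = 0` is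
  -- allowed.
  have hq : Fin K → 0 < q := fun k => by have := hr k; omega
  have ht : ∀ k, 0 < θ * (√(q : ℝ) + √((IRRR.view X k).rank : ℝ)) := fun k => by
    have : 0 < √(q : ℝ) := Real.sqrt_pos.2 (by exact_mod_cast hq k)
    positivity
  -- With `t = θ(√q + √r(X_k))` the noise level `τ(√r(X_k) + √q + t)` is exactly `λ/2 (√q +
  -- √r(X_k))`, and `t² ≥ θ²(q + r(X_k))`.
  choose A hA hPA hAE using fun k =>
    IRRR.exists_measurableSet_bilinear_le (IRRR.view X k) hτ hlaw hindep (ht k)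
  refine ⟨⋂ k, A k, MeasurableSet.iInter hA, ?_, fun ω hω Bhat hest => ?_⟩
  · have h1 : P.real (⋃ k, (A k)ᶜ) ≤ ∑ k, P.real (A k)ᶜ := measureReal_iUnion_fintype_le _
    have h2 : P.real (⋂ k, A k) = 1 - P.real (⋃ k, (A k)ᶜ) := by
      rw [← Set.compl_iInter, probReal_compl_eq_one_sub (MeasurableSet.iInter hA)]
      ring
    have h3 : ∑ k, P.real (A k)ᶜ ≤
        ∑ k, Real.exp (-(θ ^ 2 * ((q : ℝ) + ((IRRR.view X k).rank : ℝ)) / 2)) := by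
      refine Finset.sum_le_sum fun k _ => ?_
      rw [probReal_compl_eq_one_sub (hA k)]
      have h4 : Real.exp (-((θ * (√(q : ℝ) + √((IRRR.view X k).rank : ℝ))) ^ 2 / 2)) ≤
          Real.exp (-(θ ^ 2 * ((q : ℝ) + ((IRRR.view X k).rank : ℝ)) / 2)) := by
        rw [Real.exp_le_exp, mul_pow, add_sq, Real.sq_sqrt (by positivity),
          Real.sq_sqrt (by positivity)]
        have h5 : 0 ≤ θ ^ 2 * (2 * √(q : ℝ) * √((IRRR.view X k).rank : ℝ)) := by positivity
        linarith
      linarith [hPA k]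
    linarith
  · have hlam : 0 < 2 * (1 + θ) * τ := by positivity
    have hE : ∀ k x v, (IRRR.view X k *ᵥ x) ⬝ᵥ (IRRR.view X k *ᵥ x) ≤ 1 → v ⬝ᵥ v = 1 →
        (IRRR.view X k *ᵥ x) ⬝ᵥ (E ω *ᵥ v) ≤
          2 * (1 + θ) * τ / 2 * (√(q : ℝ) + √((IRRR.view X k).rank : ℝ)) := by
      intro k x v hx hv
      refine (hAE k ω (Set.mem_iInter.1 hω k) x v hx hv).trans (le_of_eq ?_)
      ring
    set b₁ := τ ^ 2 * (1 + θ) ^ 2 * ∑ k,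
      IRRR.eigLambda (IRRR.gram (IRRR.view X k)) (IRRR.gram_isHermitian _) 1 / κ ^ 2 *
        ((√(q : ℝ) + √((IRRR.view X k).rank : ℝ)) ^ 2 * (r k : ℝ) / n) with hb₁
    set b₂ := τ * (1 + θ) * ∑ k,
      √(IRRR.eigLambda (IRRR.gram (IRRR.view X k)) (IRRR.gram_isHermitian _) 1) / κ *
        ((√(q : ℝ) + √((IRRR.view X k).rank : ℝ)) *
          IRRR.tailSum (IRRR.block B₀ k) (r k) / √(n : ℝ)) with hb₂
    have hm₀ : δ ^ 2 ≤ max (δ ^ 2) (max b₁ b₂) := le_max_left _ _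
    have hm₁ : b₁ ≤ max (δ ^ 2) (max b₁ b₂) := (le_max_left _ _).trans (le_max_right _ _)
    have hm₂ : b₂ ≤ max (δ ^ 2) (max b₁ b₂) := (le_max_right _ _).trans (le_max_right _ _)
    rcases IRRR.norm_sq_sub_le hn hSVD (fun k => (hr k).2) hRE hlam hE hest with h | h
    · linarith [sq_nonneg δ]
    · have h1 : 9 / 2 * (2 * (1 + θ) * τ) ^ 2 / κ ^ 2 * ∑ k, IRRR.weight q X k ^ 2 * r k ≤
          18 * b₁ := by
        rw [hb₁, Finset.mul_sum, Finset.mul_sum, Finset.mul_sum]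
        refine Finset.sum_le_sum fun k _ => ?_
        have h2 := mul_le_mul_of_nonneg_left (IRRR.weight_sq_le (q := q) hn X (hp k))
          (by positivity : 0 ≤ 18 * (τ ^ 2 * (1 + θ) ^ 2) / κ ^ 2 * (r k : ℝ))
        calc _ = 18 * (τ ^ 2 * (1 + θ) ^ 2) / κ ^ 2 * (r k : ℝ) * IRRR.weight q X k ^ 2 := by ring
          _ ≤ _ := h2
          _ = _ := by ring
      have h2 : 4 * (2 * (1 + θ) * τ) / κ * ∑ k, IRRR.weight q X k *
          IRRR.tailSum (IRRR.block B₀ k) (r k) ≤ 8 * b₂ := by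
        rw [hb₂, Finset.mul_sum, Finset.mul_sum, Finset.mul_sum]
        refine Finset.sum_le_sum fun k _ => ?_
        have h3 := mul_le_mul_of_nonneg_left (IRRR.weight_le (q := q) hn X (hp k))
          (mul_nonneg (by positivity : 0 ≤ 8 * (τ * (1 + θ)) / κ)
            (IRRR.tailSum_nonneg (IRRR.block B₀ k) (r k)))
        calc _ = 8 * (τ * (1 + θ)) / κ * IRRR.tailSum (IRRR.block B₀ k) (r k) *
              IRRR.weight q X k := by ring
          _ ≤ _ := h3
          _ = _ := by ring
      linarith
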